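/- Let $j,k,n$ be positive integers with $j+k<n$. Let $G_j(X)$ denote the set of $j$-dimensional linear subspaces of a Euclidean space $X$, with its canonical $O(X)$-invariant probability measure, and let $G(n,j)$ denote the set of $j$-dimensional affine planes $\tau=\xi+u$ in $\mathbb R^n$ ($\xi\in G_j(\mathbb R^n)$, $u\in\xi^\perp$), with the measure $d\tau=d\xi\,du$, where $du$ is Lebesgue measure on $\xi^\perp$; similarly for $k$. For a plane $\zeta=\eta+v\in G(n,k)$ ($\eta\in G_k(\mathbb R^n)$, $v\in\eta^\perp$) and a plane $\tau=\xi+u\in G(n,j)$ put $$(R_{j,k}f)(\zeta)=\int_{G_j(\eta^\perp)}d\xi\int_{\eta}f(\xi+u+v)\,du,\qquad (R_{k,j}\varphi)(\tau)=\int_{G_k(\xi^\perp)}d\eta\int_{\xi}\varphi(\eta+u+v)\,dv,$$ the integrals of $f$ and $\varphi$ over all planes that meet the given plane at a right angle (all integrals are Lebesgue integrals, with the Lebesgue measures of $\eta$ and $\xi$ as inner measures). "Finite" means that the integral converges absolutely. (i) If $f\in L^p(G(n,j))$, $1\le p<(n-j)/k$, then $(R_{j,k}f)(\zeta)$ is finite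 for almost all $\zeta\in G(n,k)$. (ii) If $\varphi\in L^q(G(n,k))$, $1\le q<(n-k)/j$, then $(R_{k,j}\varphi)(\tau)$ is finite for almost all $\tau\in G(n,j)$. Both bounds are sharp: for every $p$ with $(n-j)/k\le p\le\infty$ there is a nonnegative $f\in L^p(G(n,j))$ with $(R_{j,k}f)(\zeta)=\infty$ for all $\zeta\in G(n,k)$, and for every $q$ with $(n-k)/j\le q\le\infty$ there is a nonnegative $\varphi\in L^q(G(n,k))$ with $(R_{k,j}\varphi)(\tau)=\infty$ for all $\tau\in G(n,j)$. -/

import Mathlib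

open MeasureTheory Module
open scoped ENNReal

noncomputable section

/-! ### The orthogonal group of a Euclidean space -/

section Orthogonal

variable (V : Type*) [NormedAddCommGroup V] [InnerProductSpace ℝ V] [FiniteDimensional ℝ V]

/-- The orthogonal group `O(V)`, as a topological group (with the topology of operators). -/
abbrev OrthGroup [CompleteSpace V] : Type _ := unitary (V →L[ℝ] V)

instance OrthGroup.instCompactSpace [CompleteSpace V] : CompactSpace (OrthGroup V) := by
  have : ProperSpace (V →L[ℝ] V) := FiniteDimensional.proper ℝ _
  have hb : Bornology.IsBounded ((unitary (V →L[ℝ] V) : Submonoid (V →L[ℝ] V)) :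
      Set (V →L[ℝ] V)) := by
    refine (Metric.isBounded_closedBall (x := (0 : V →L[ℝ] V)) (r := 1)).subset ?_
    intro u hu
    rw [mem_closedBall_zero_iff]
    refine ContinuousLinearMap.opNorm_le_bound _ zero_le_one fun x => ?_
    rw [one_mul]
    exact (Unitary.norm_map ⟨u, hu⟩ x).le
  exact isCompact_iff_compactSpace.mp
    (Metric.isCompact_of_isClosed_isBounded isClosed_unitary hb)

/-- The Haar probability measure `dγ` on `O(V)`. -/
def orthHaar [CompleteSpace V] : Measure (OrthGroup V) :=
  Measure.haarMeasure (⊤ : TopologicalSpace.PositiveCompacts (OrthGroup V))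

end Orthogonal

/-! ### Linear and affine Grassmannians -/

/-- `G_j(V)`: the set of all `j`-dimensional linear subspaces of `V`. -/
@[ext]
structure LinGrass (j : ℕ) (V : Type*) [NormedAddCommGroup V] [InnerProductSpace ℝ V] where
  toSubmodule : Submodule ℝ V
  finrank_eq : finrank ℝ toSubmodule = j

/-- `G(j, V)`: the set of all `j`-dimensional affine planes in `V`. -/
@[ext]
structure AffGrass (j : ℕ) (V : Type*) [NormedAddCommGroup V] [InnerProductSpace ℝ V] where
  toAffineSubspace : AffineSubspace ℝ V
  nonempty : (toAffineSubspace : Set V).Nonempty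
  finrank_direction : finrank ℝ toAffineSubspace.direction = j

section Grassmannians

variable {j k : ℕ} {V : Type*} [NormedAddCommGroup V] [InnerProductSpace ℝ V]

/-- The plane `ξ + x` through `x` parallel to `ξ`. -/
def LinGrass.plane (ξ : LinGrass j V) (x : V) : AffGrass j V :=
  ⟨AffineSubspace.mk' x ξ.1, ⟨x, AffineSubspace.self_mem_mk' x ξ.1⟩, by
    rw [AffineSubspace.direction_mk']; exact ξ.2⟩

/-- The linear subspace `ξ` parallel to the plane `τ = ξ + u`. -/
def AffGrass.dir (τ : AffGrass j V) : LinGrass j V := ⟨τ.1.direction, τ.3⟩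

theorem LinGrass.dir_plane (ξ : LinGrass j V) (x : V) : (ξ.plane x).dir = ξ :=
  LinGrass.ext (AffineSubspace.direction_mk' x ξ.1)

/-- A `j`-dimensional subspace of a subspace `U` of `V`, seen as a subspace of `V`. -/
def LinGrass.incl {U : Submodule ℝ V} (ξ : LinGrass j U) : LinGrass j V :=
  ⟨ξ.1.map U.subtype, by rw [U.finrank_map_subtype_eq]; exact ξ.2⟩

variable [FiniteDimensional ℝ V]

/-- The Borel σ-algebra of `G_j(V)`. The usual topology is the one in which a subspace is
identified with the orthogonal projection onto it. -/
instance LinGrass.instMeasurableSpace : MeasurableSpace (LinGrass j V) :=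
  MeasurableSpace.comap (fun W : LinGrass j V => W.1.starProjection) (borel (V →L[ℝ] V))

/-- The point `u` of `τ = ξ + u` that is orthogonal to `ξ`: the common projection onto `ξᗮ` of
all the points of `τ`. -/
def AffGrass.foot (τ : AffGrass j V) : V := τ.1.directionᗮ.starProjection τ.2.some

theorem LinGrass.foot_plane (ξ : LinGrass j V) (x : V) :
    (ξ.plane x).foot = ξ.1ᗮ.starProjection x := by
  have hmem := (ξ.plane x).2.some_mem
  have hd : (ξ.plane x).1.direction = ξ.1 := AffineSubspace.direction_mk' x ξ.1
  have h : (ξ.plane x).2.some - x ∈ ξ.1 := by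
    have := (AffineSubspace.mem_mk' (p := x) (direction := ξ.1)).1 hmem
    simpa using this
  have h0 : ξ.1ᗮ.starProjection ((ξ.plane x).2.some - x) = 0 := by
    rw [Submodule.starProjection_apply_eq_zero_iff, Submodule.orthogonal_orthogonal]
    exact h
  rw [map_sub, sub_eq_zero] at h0
  rw [AffGrass.foot, ← h0]
  congr 2
  rw [hd]

theorem AffGrass.plane_dir_foot (τ : AffGrass j V) : τ.dir.plane τ.foot = τ := by
  have hmem := τ.2.some_mem
  apply AffGrass.ext
  change AffineSubspace.mk' τ.foot τ.1.direction = τ.1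
  have hf : τ.foot ∈ τ.1 := by
    have h1 : τ.foot - τ.2.some ∈ τ.1.direction := by
      have : τ.foot - τ.2.some = -(τ.1.direction.starProjection τ.2.some) := by
        rw [AffGrass.foot, Submodule.starProjection_orthogonal']
        simp
      rw [this]
      exact neg_mem (Submodule.starProjection_apply_mem _ _)
    have := AffineSubspace.vadd_mem_of_mem_direction h1 hmem
    simpa using this
  exact AffineSubspace.mk'_eq hf

/-- The Borel σ-algebra of `G(j, V)`, for its usual topology as the bundle of the pairs `(ξ, u)`
with `ξ ∈ G_j(V)` and `u ∈ ξᗮ`. -/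
instance AffGrass.instMeasurableSpace [MeasurableSpace V] : MeasurableSpace (AffGrass j V) :=
  MeasurableSpace.comap (fun τ : AffGrass j V => (τ.dir, τ.foot)) inferInstance

/-- The image `γ ξ` of a subspace under an orthogonal transformation. -/
def LinGrass.rotate [CompleteSpace V] (γ : OrthGroup V) (ξ : LinGrass j V) : LinGrass j V :=
  ⟨ξ.1.map ((Unitary.linearIsometryEquiv γ).toLinearEquiv : V →ₗ[ℝ] V), by
    rw [LinearEquiv.finrank_map_eq]; exact ξ.2⟩

/-! The maps used below to push measures forward are measurable. -/

theorem LinGrass.measurable_of_starProjection {α : Type*} [MeasurableSpace α]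
    {F : α → LinGrass j V} (hF : @Measurable _ _ _ (borel (V →L[ℝ] V))
      fun a => (F a).1.starProjection) : Measurable F := by
  rintro s ⟨t, ht, rfl⟩
  exact hF ht

theorem LinGrass.measurable_starProjection :
    Measurable fun ξ : LinGrass j V => ξ.1.starProjection := by
  rintro t ht
  exact ⟨t, ht, rfl⟩

theorem LinGrass.measurable_rotate [CompleteSpace V] (ξ : LinGrass j V) :
    Measurable fun γ : OrthGroup V => LinGrass.rotate γ ξ := by
  refine LinGrass.measurable_of_starProjection ?_
  have h : (fun γ : OrthGroup V => (LinGrass.rotate γ ξ).1.starProjection) =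
      fun γ : OrthGroup V => (γ : V →L[ℝ] V) * ξ.1.starProjection * star (γ : V →L[ℝ] V) := by
    funext γ
    ext x
    exact Submodule.starProjection_map_apply (Unitary.linearIsometryEquiv γ) ξ.1 x
  rw [h]
  have hc : Continuous fun γ : OrthGroup V =>
      (γ : V →L[ℝ] V) * ξ.1.starProjection * star (γ : V →L[ℝ] V) := by fun_prop
  exact hc.measurable

theorem LinGrass.measurable_incl {U : Submodule ℝ V} :
    Measurable (LinGrass.incl : LinGrass j U → LinGrass j V) := by
  refine LinGrass.measurable_of_starProjection ?_
  have h : (fun ξ : LinGrass j U => ξ.incl.1.starProjection) =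
      (fun T : U →L[ℝ] U => U.subtypeL ∘L T ∘L U.orthogonalProjectionOnto) ∘
        fun ξ : LinGrass j U => ξ.1.starProjection := by
    funext ξ
    ext x
    change (ξ.1.map U.subtype).starProjection x =
      ((ξ.1.starProjection (U.orthogonalProjectionOnto x) : U) : V)
    refine Submodule.eq_starProjection_of_mem_of_inner_eq_zero (K := ξ.1.map U.subtype)
      (Submodule.mem_map_of_mem (Submodule.starProjection_apply_mem _ _)) ?_
    rintro _ ⟨w, hw, rfl⟩
    have h1 := ξ.1.starProjection_inner_eq_zero (U.orthogonalProjectionOnto x) w hw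
    have h2 := U.starProjection_inner_eq_zero x (w : V) w.2
    rw [Submodule.coe_inner, Submodule.coe_sub, inner_sub_left] at h1
    rw [inner_sub_left] at h2
    change inner ℝ (x - _) (w : V) = 0
    rw [inner_sub_left]
    rw [Submodule.starProjection_apply] at h2
    linarith
  rw [h]
  have hc : Continuous fun T : U →L[ℝ] U => U.subtypeL ∘L T ∘L U.orthogonalProjectionOnto := by
    fun_prop
  exact hc.measurable.comp LinGrass.measurable_starProjection

variable [MeasurableSpace V] [BorelSpace V]

theorem LinGrass.measurable_plane :
    Measurable fun q : LinGrass j V × V => q.1.plane q.2 := by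
  rintro s ⟨t, ht, rfl⟩
  have h : Measurable fun q : LinGrass j V × V => ((q.1.plane q.2).dir, (q.1.plane q.2).foot) := by
    simp only [LinGrass.dir_plane, LinGrass.foot_plane, Submodule.starProjection_orthogonal']
    refine measurable_fst.prodMk ?_
    have hc : Continuous fun q : (V →L[ℝ] V) × V => (1 - q.1) q.2 := by fun_prop
    exact hc.measurable.comp
      ((LinGrass.measurable_starProjection.comp measurable_fst).prodMk measurable_snd)
  exact h ht

/-- The Lebesgue measures of the fibres of `G(j, V) → G_j(V)` depend measurably on the base
point. -/
theorem LinGrass.measurable_fibreMeasure :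
    Measurable fun ξ : LinGrass j V =>
      (volume : Measure ξ.1ᗮ).map (fun u : ξ.1ᗮ => ξ.plane (u : V)) := by
  have hpl (ξ : LinGrass j V) : Measurable fun x : V => ξ.plane x :=
    LinGrass.measurable_plane.comp (measurable_const.prodMk measurable_id)
  refine Measure.measurable_of_measurable_coe _ fun B hB => ?_
  set S : Set (LinGrass j V × V) :=
    {q | q.1.plane q.2 ∈ B ∧ ‖q.1.1.starProjection q.2‖ < 1} with hS
  have hSm : MeasurableSet S := by
    refine (LinGrass.measurable_plane hB).inter ?_
    have hc : Continuous fun q : (V →L[ℝ] V) × V => ‖q.1 q.2‖ := by fun_prop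
    exact measurableSet_lt (hc.measurable.comp
      ((LinGrass.measurable_starProjection.comp measurable_fst).prodMk measurable_snd))
      measurable_const
  set c : ℝ≥0∞ := volume (Metric.ball (0 : EuclideanSpace ℝ (Fin j)) 1) with hc
  have hc0 : c ≠ 0 := (Metric.measure_ball_pos _ _ one_pos).ne'
  have hct : c ≠ ∞ := measure_ball_lt_top.ne
  have key (ξ : LinGrass j V) :
      ((volume : Measure ξ.1ᗮ).map (fun u : ξ.1ᗮ => ξ.plane (u : V))) B =
        c⁻¹ * volume (Prod.mk ξ ⁻¹' S) := by
    have hm : Measurable fun u : ξ.1ᗮ => ξ.plane (u : V) := (hpl ξ).comp measurable_subtype_coe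
    have hmp := ξ.1.measurePreserving_measurableEquivProd (0 : V)
    rw [InnerProductSpace.euclideanHausdorffMeasure_eq_volume] at hmp
    have hpre : Prod.mk ξ ⁻¹' S = ξ.1.measurableEquivProd (0 : V) ⁻¹'
        (Metric.ball (0 : ξ.1) 1 ×ˢ ((fun u : ξ.1ᗮ => ξ.plane (u : V)) ⁻¹' B)) := by
      ext x
      have hp : ξ.plane (ξ.1ᗮ.starProjection x) = ξ.plane x := by
        rw [← LinGrass.foot_plane]
        conv_rhs => rw [← AffGrass.plane_dir_foot (ξ.plane x), LinGrass.dir_plane]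
      have hp' : ξ.plane ((ξ.1ᗮ.orthogonalProjectionOnto x : ξ.1ᗮ) : V) = ξ.plane x := hp
      simp only [hS, Set.mem_preimage, Set.mem_ofPred_eq, Set.mem_prod, mem_ball_zero_iff,
        Submodule.measurableEquivProd_apply, vsub_eq_sub, sub_zero, hp']
      rw [and_comm]
      rfl
    have hball : volume (Metric.ball (0 : ξ.1) 1) = c := by
      let e := ((stdOrthonormalBasis ℝ ξ.1).reindex (finCongr ξ.2)).repr
      rw [hc, ← e.measurePreserving.measure_preimage measurableSet_ball.nullMeasurableSet]
      simp
    rw [hpre, hmp.measure_preimage_equiv, Measure.volume_eq_prod, Measure.prod_prod, hball,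
      Measure.map_apply hm hB, ← mul_assoc, ENNReal.inv_mul_cancel hc0 hct, one_mul]
  simp only [key]
  exact (measurable_measure_prodMk_left hSm).const_mul _

end Grassmannians

/-! ### Measures on Grassmannians -/

section Measures

variable (j : ℕ) {k : ℕ} (V : Type*) [NormedAddCommGroup V] [InnerProductSpace ℝ V]
  [FiniteDimensional ℝ V]

open Classical in
/-- The canonical `O(V)`-invariant probability measure `dξ` on `G_j(V)`: the image of the Haar
probability measure of `O(V)` under `γ ↦ γ ξ₀`, where `ξ₀ ∈ G_j(V)` is fixed (it does not matter
which). If `j > dim V` then `G_j(V)` is empty. -/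
def linGrassMeasure [CompleteSpace V] : Measure (LinGrass j V) :=
  if h : Nonempty (LinGrass j V) then
    (orthHaar V).map (fun γ => LinGrass.rotate γ h.some)
  else 0

variable [MeasurableSpace V] [BorelSpace V]

/-- The measure `dτ = dξ du` on `G(j, V)`:
`∫ f(τ) dτ = ∫_{G_j(V)} dξ ∫_{ξᗮ} f(ξ + u) du`, with Lebesgue measure `du` on `ξᗮ`. -/
def affGrassMeasure [CompleteSpace V] : Measure (AffGrass j V) :=
  (linGrassMeasure j V).bind
    (fun ξ => (volume : Measure ξ.1ᗮ).map (fun u : ξ.1ᗮ => ξ.plane (u : V)))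

variable {V}

/-- The measure `d_ζ τ` on the set of all `j`-planes that are perpendicular to the `k`-plane
`ζ = η + v` (`v ∈ ηᗮ`) and meet it:
`∫ f(τ) d_ζ τ = ∫_{G_j(ηᗮ)} dξ ∫_η f(ξ + u + v) du`. -/
def perpMeasure [CompleteSpace V] (ζ : AffGrass k V) : Measure (AffGrass j V) :=
  ((linGrassMeasure j ζ.dir.1ᗮ).prod (volume : Measure ζ.dir.1)).map
    (fun q => q.1.incl.plane ((q.2 : V) + ζ.foot))

/-! ### The mixed Radon transform -/

/-- The mixed Radon transform `R_{j,k} F : G(k, V) → [0, ∞]` of a nonnegative function `F` on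
`G(j, V)`. -/
def mixedRadon [CompleteSpace V] (F : AffGrass j V → ℝ≥0∞) (ζ : AffGrass k V) : ℝ≥0∞ :=
  ∫⁻ τ, F τ ∂(perpMeasure j ζ)

/-- `(R_{j,k} f)(ζ)` exists as a finite Lebesgue integral: `f` is `d_ζ τ`-measurable and
`(R_{j,k} |f|)(ζ) < ∞`. -/
def MixedRadonFinite [CompleteSpace V] (f : AffGrass j V → ℂ) (ζ : AffGrass k V) : Prop :=
  AEStronglyMeasurable f (perpMeasure j ζ) ∧ mixedRadon j (fun τ => ‖f τ‖ₑ) ζ < ∞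

end Measures

end

/-! Put `l = n - j - k`. Fix orthogonal subspaces `η` and `ξ` of dimensions `k` and `j`. By
invariance of Haar measure and Tonelli, the pairing of `φ` with `R_{j,k} F` equals the integral of
`φ(γη + x) F(γξ + x)` over `γ ∈ O(V)` and `x ∈ V`. This expression is symmetric, so the two
transforms are dual (`lintegral_mul_mixedRadon_comm`).

Existence: let `φ` be the indicator of the `k`-planes at distance less than `R` from the origin. At
a `j`-plane with foot `u`, the dual transform of `φ` is at most a constant times the probability
that a random `k`-subspace of a `(k + l)`-dimensional space passes within `R` of `u`. That
probability is `O((1 + ‖u‖)^{-l})` (`linGrassMeasure_dist_lt_mul_one_add_pow_le`). For `p > 1` the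
weight lies in `L^{p'}` because `l p' > k + l`, which is the same as `p k < k + l`; for `p = 1` it
is bounded. Hölder's inequality then makes `R_{j,k} F` integrable over the planes near the origin,
hence finite almost everywhere (`ae_mixedRadon_lt_top`).

Sharpness: `(1 + r)^{-k} / (1 + log (1 + r))`, with `r` the distance to the origin, is in `L^p` as
soon as `p k ≥ k + l`, since then `p > 1` and the logarithm gives convergence at the endpoint
(`memLp_extremalProfile_foot`). On a `k`-dimensional space it behaves like `dr / (r log r)` and
diverges (`mixedRadon_extremalProfile_foot`).

The Grassmannian of `ηᗮ` varies with `η`, so measurability in `η` is not automatic. It is checked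
after pulling back along the surjection `γ ↦ γη` from the standard Borel space `O(V)`. -/

set_option linter.unusedSectionVars false

/-! ### Haar measure on the orthogonal group. -/

noncomputable section OrthGroupHaar

variable {j k : ℕ} {V W : Type*} [NormedAddCommGroup V] [InnerProductSpace ℝ V]
  [FiniteDimensional ℝ V] [CompleteSpace V] [NormedAddCommGroup W] [InnerProductSpace ℝ W]
  [FiniteDimensional ℝ W] [CompleteSpace W]

instance OrthGroup.instStandardBorelSpace : StandardBorelSpace (OrthGroup V) :=
  have : PolishSpace (V →L[ℝ] V) := by
    have : ProperSpace (V →L[ℝ] V) := FiniteDimensional.proper ℝ _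
    infer_instance
  (isClosed_unitary (R := V →L[ℝ] V)).measurableSet.standardBorel

instance orthHaar.instIsHaarMeasure : (orthHaar V).IsHaarMeasure := by
  unfold orthHaar; infer_instance

instance orthHaar.instIsProbabilityMeasure : IsProbabilityMeasure (orthHaar V) :=
  ⟨by rw [orthHaar]; exact Measure.haarMeasure_self⟩

/-- A right translate of the Haar probability measure is again a Haar probability measure, and there
is only one. -/
instance orthHaar.instIsMulRightInvariant : (orthHaar V).IsMulRightInvariant := by
  refine ⟨fun g => ?_⟩
  have : IsProbabilityMeasure ((orthHaar V).map (· * g)) :=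
    Measure.isProbabilityMeasure_map (measurable_mul_const g).aemeasurable
  exact Measure.isHaarMeasure_eq_of_isProbabilityMeasure _ _

/-- Conjugation by an isometry of Euclidean spaces, as a homomorphism of orthogonal groups. -/
def OrthGroup.conj (e : V ≃ₗᵢ[ℝ] W) : OrthGroup V →* OrthGroup W where
  toFun γ := ⟨e.conjStarAlgEquiv γ, Unitary.map_mem _ γ.2⟩
  map_one' := Subtype.ext (map_one _)
  map_mul' _ _ := Subtype.ext (map_mul _ _ _)

theorem OrthGroup.conj_apply (e : V ≃ₗᵢ[ℝ] W) (γ : OrthGroup V) (x : W) :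
    (OrthGroup.conj e γ : W →L[ℝ] W) x = e ((γ : V →L[ℝ] V) (e.symm x)) := rfl

theorem OrthGroup.measurePreserving_conj (e : V ≃ₗᵢ[ℝ] W) :
    MeasurePreserving (OrthGroup.conj e) (orthHaar V) (orthHaar W) := by
  refine MonoidHom.measurePreserving ?_ ?_ (by simp)
  · refine Continuous.subtype_mk ?_ _
    have : Continuous fun T : V →L[ℝ] V =>
        (e : V →L[ℝ] W) ∘L T ∘L (e.symm : W →L[ℝ] V) := by fun_prop
    exact this.comp continuous_subtype_val
  · intro γ
    refine ⟨OrthGroup.conj e.symm γ, Subtype.ext (ContinuousLinearMap.ext fun x => ?_)⟩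
    simp [OrthGroup.conj_apply]

end OrthGroupHaar

/-- The σ-algebra pulled back along an injection is countably generated and separates points, and it
is contained in the given one. -/
theorem MeasurableSpace.CountablySeparated.of_injective {α β : Type*} [MeasurableSpace α]
    [mβ : MeasurableSpace β] [CountablyGenerated β] [SeparatesPoints β] {f : α → β}
    (hf : Measurable f) (hinj : Function.Injective f) : CountablySeparated α := by
  have h1 : @CountablyGenerated α (.comap f mβ) := .comap f
  have h2 : @SeparatesPoints α (.comap f mβ) := by
    refine @SeparatesPoints.mk _ (.comap f mβ) fun x y h => ?_
    refine hinj (separatesPoints_def fun s hs hx => ?_)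
    exact h (f ⁻¹' s) ⟨s, hs, rfl⟩ hx
  have h3 : @CountablySeparated α (.comap f mβ) :=
    @countablySeparated_of_separatesPoints _ (.comap f mβ) h1 h2
  exact h3.mono hf.comap_le

/-! ### Isometries acting on Grassmannians, and measurability. -/

noncomputable section GrassmannMeasure

variable {j k : ℕ} {V W : Type*} [NormedAddCommGroup V] [InnerProductSpace ℝ V]
  [NormedAddCommGroup W] [InnerProductSpace ℝ W]

/-- The image of a subspace under an isometry of Euclidean spaces. -/
def LinGrass.mapIso (e : V ≃ₗᵢ[ℝ] W) (ξ : LinGrass j V) : LinGrass j W :=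
  ⟨ξ.1.map (e.toLinearEquiv : V →ₗ[ℝ] W), by rw [LinearEquiv.finrank_map_eq]; exact ξ.2⟩

theorem LinGrass.rotate_mul [CompleteSpace V] (γ δ : OrthGroup V) (ξ : LinGrass j V) :
    ξ.rotate (γ * δ) = (ξ.rotate δ).rotate γ := by
  refine LinGrass.ext (SetLike.coe_injective ?_)
  change _ '' _ = _ '' (_ '' _)
  rw [Set.image_image]
  rfl

variable [FiniteDimensional ℝ V] [CompleteSpace V] [FiniteDimensional ℝ W] [CompleteSpace W]

theorem LinGrass.starProjection_mapIso (e : V ≃ₗᵢ[ℝ] W) (ξ : LinGrass j V) :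
    (ξ.mapIso e).1.starProjection =
      (e : V →L[ℝ] W) ∘L ξ.1.starProjection ∘L (e.symm : W →L[ℝ] V) := by
  ext x
  exact Submodule.starProjection_map_apply e ξ.1 x

theorem LinGrass.measurable_mapIso (e : V ≃ₗᵢ[ℝ] W) :
    Measurable (LinGrass.mapIso e : LinGrass j V → LinGrass j W) := by
  refine LinGrass.measurable_of_starProjection ?_
  simp only [LinGrass.starProjection_mapIso]
  have : Continuous fun T : V →L[ℝ] V =>
        (e : V →L[ℝ] W) ∘L T ∘L (e.symm : W →L[ℝ] V) := by fun_prop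
  exact this.measurable.comp LinGrass.measurable_starProjection

theorem LinGrass.measurable_rotate_uncurry :
    Measurable fun q : OrthGroup V × LinGrass j V => q.2.rotate q.1 := by
  refine LinGrass.measurable_of_starProjection ?_
  have h : (fun q : OrthGroup V × LinGrass j V => (q.2.rotate q.1).1.starProjection) =
      fun q => (q.1 : V →L[ℝ] V) * q.2.1.starProjection * star (q.1 : V →L[ℝ] V) := by
    funext q
    ext x
    exact Submodule.starProjection_map_apply (Unitary.linearIsometryEquiv q.1) q.2.1 x
  rw [h]
  have hc : Continuous fun q : OrthGroup V × (V →L[ℝ] V) =>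
      (q.1 : V →L[ℝ] V) * q.2 * star (q.1 : V →L[ℝ] V) := by fun_prop
  exact hc.measurable.comp
    (measurable_fst.prodMk (LinGrass.measurable_starProjection.comp measurable_snd))

/-- Together with the standard Borel structure of `O(V)`, this lets measurability descend along `γ ↦
γη`. -/
instance LinGrass.instCountablySeparated : MeasurableSpace.CountablySeparated (LinGrass j V) :=
  .of_injective LinGrass.measurable_starProjection fun _ _ h =>
    LinGrass.ext (Submodule.starProjection_inj.1 h)

end GrassmannMeasure

/-! ### Invariant measures on Grassmannians and on orthogonal pairs. -/

noncomputable section Flags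

variable {j k : ℕ} {V W : Type*} [NormedAddCommGroup V] [InnerProductSpace ℝ V]
  [NormedAddCommGroup W] [InnerProductSpace ℝ W]
  [FiniteDimensional ℝ V] [CompleteSpace V] [FiniteDimensional ℝ W] [CompleteSpace W]

theorem OrthGroup.exists_extend {U : Submodule ℝ V} (L : U →ₗᵢ[ℝ] V) :
    ∃ γ : OrthGroup V, ∀ x : U, (γ : V →L[ℝ] V) x = L x := by
  refine ⟨Unitary.linearIsometryEquiv.symm (L.extend.toLinearIsometryEquiv rfl), fun x => ?_⟩
  rw [← L.extend_apply x]
  rfl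

theorem LinGrass.exists_rotate_eq (ξ ξ' : LinGrass j V) : ∃ γ : OrthGroup V, ξ.rotate γ = ξ' := by
  let e : ξ.1 ≃ₗᵢ[ℝ] ξ'.1 :=
    ((stdOrthonormalBasis ℝ ξ.1).reindex (finCongr (ξ.2.trans ξ'.2.symm))).repr.trans
      (stdOrthonormalBasis ℝ ξ'.1).repr.symm
  obtain ⟨γ, hγ⟩ := OrthGroup.exists_extend (ξ'.1.subtypeₗᵢ.comp e.toLinearIsometry)
  refine ⟨γ, LinGrass.ext (SetLike.coe_injective ?_)⟩
  ext y
  constructor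
  · rintro ⟨x, hx, rfl⟩
    have := hγ ⟨x, hx⟩
    change (γ : V →L[ℝ] V) x ∈ ξ'.1
    rw [this]
    exact (e ⟨x, hx⟩).2
  · intro hy
    refine ⟨e.symm ⟨y, hy⟩, (e.symm ⟨y, hy⟩).2, ?_⟩
    refine (hγ _).trans ?_
    simp

theorem linGrassMeasure_eq_map (ξ : LinGrass j V) :
    linGrassMeasure j V = (orthHaar V).map fun γ => ξ.rotate γ := by
  have h : Nonempty (LinGrass j V) := ⟨ξ⟩
  rw [linGrassMeasure, dif_pos h]
  -- The base point in the definition is `δ ξ`; right invariance absorbs `δ`.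
  obtain ⟨δ, hδ⟩ := LinGrass.exists_rotate_eq ξ h.some
  have : (fun γ : OrthGroup V => h.some.rotate γ) = (fun γ => ξ.rotate γ) ∘ (· * δ) := by
    funext γ
    simp [LinGrass.rotate_mul, hδ]
  rw [this, ← Measure.map_map (LinGrass.measurable_rotate ξ) (measurable_mul_const δ),
    map_mul_right_eq_self]

theorem isProbabilityMeasure_linGrassMeasure (ξ : LinGrass j V) :
    IsProbabilityMeasure (linGrassMeasure j V) := by
  rw [linGrassMeasure_eq_map ξ]
  exact Measure.isProbabilityMeasure_map (LinGrass.measurable_rotate ξ).aemeasurable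

instance linGrassMeasure.instIsFiniteMeasure : IsFiniteMeasure (linGrassMeasure j V) := by
  by_cases h : Nonempty (LinGrass j V)
  · have := isProbabilityMeasure_linGrassMeasure h.some
    infer_instance
  · rw [linGrassMeasure, dif_neg h]
    infer_instance

theorem linGrassMeasure_univ_le_one : linGrassMeasure j V Set.univ ≤ 1 := by
  by_cases h : Nonempty (LinGrass j V)
  · have := isProbabilityMeasure_linGrassMeasure h.some
    exact prob_le_one
  · rw [linGrassMeasure, dif_neg h]
    simp

/-- The isometry `e` intertwines rotation by `γ` with rotation by its conjugate, and conjugation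
preserves Haar measure. -/
theorem LinGrass.measurePreserving_mapIso (e : V ≃ₗᵢ[ℝ] W) :
    MeasurePreserving (LinGrass.mapIso e : LinGrass j V → LinGrass j W)
      (linGrassMeasure j V) (linGrassMeasure j W) := by
  refine ⟨LinGrass.measurable_mapIso e, ?_⟩
  by_cases h : Nonempty (LinGrass j V)
  · obtain ⟨ξ⟩ := h
    rw [linGrassMeasure_eq_map ξ, linGrassMeasure_eq_map (ξ.mapIso e),
      Measure.map_map (LinGrass.measurable_mapIso e) (LinGrass.measurable_rotate ξ),
      ← (OrthGroup.measurePreserving_conj e).map_eq,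
      Measure.map_map (LinGrass.measurable_rotate _) (OrthGroup.measurePreserving_conj e).measurable]
    congr 1
    funext γ
    refine LinGrass.ext (SetLike.coe_injective ?_)
    change _ '' (_ '' _) = _ '' (_ '' _)
    rw [Set.image_image, Set.image_image]
    refine Set.image_congr fun x _ => ?_
    change e ((γ : V →L[ℝ] V) x) = (OrthGroup.conj e γ : W →L[ℝ] W) (e x)
    simp [OrthGroup.conj_apply]
  · have h' : ¬ Nonempty (LinGrass j W) := fun ⟨ξ⟩ => h ⟨ξ.mapIso e.symm⟩
    rw [linGrassMeasure, linGrassMeasure, dif_neg h, dif_neg h', Measure.map_zero]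

/-- The image of `U` is a separate variable `U'` because `(γη)ᗮ` equals `γ(ηᗮ)` only
propositionally. -/
theorem LinGrass.lintegral_incl_map (e : V ≃ₗᵢ[ℝ] V) {U U' : Submodule ℝ V}
    (hU : U' = U.map (e.toLinearEquiv : V →ₗ[ℝ] V)) {F : LinGrass j V → ℝ≥0∞}
    (hF : Measurable F) :
    ∫⁻ ξ : LinGrass j U', F ξ.incl ∂linGrassMeasure j U' =
      ∫⁻ ξ : LinGrass j U, F (ξ.incl.mapIso e) ∂linGrassMeasure j U := by
  subst hU
  let e' : U ≃ₗᵢ[ℝ] U.map (e.toLinearEquiv : V →ₗ[ℝ] V) := e.submoduleMap U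
  refine ((LinGrass.measurePreserving_mapIso (j := j) e').lintegral_comp
    (hF.comp LinGrass.measurable_incl)).symm.trans ?_
  refine lintegral_congr fun ξ => congrArg F ?_
  refine LinGrass.ext (SetLike.coe_injective ?_)
  change _ '' (_ '' _) = _ '' (_ '' _)
  rw [Set.image_image, Set.image_image]
  rfl

theorem LinGrass.orthogonal_rotate (γ : OrthGroup V) (η : LinGrass k V) :
    (η.rotate γ).1ᗮ =
      η.1ᗮ.map ((Unitary.linearIsometryEquiv γ).toLinearEquiv : V →ₗ[ℝ] V) :=
  (Submodule.map_orthogonal_equiv η.1 (Unitary.linearIsometryEquiv γ)).symm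

/-- Any orthogonal extension of `δ` to `V` maps `ηᗮ` onto itself, hence also `η`. -/
theorem LinGrass.exists_rotate_incl (η : LinGrass k V) (δ : OrthGroup η.1ᗮ) :
    ∃ γ : OrthGroup V, η.rotate γ = η ∧
      ∀ ξ : LinGrass j η.1ᗮ, (ξ.rotate δ).incl = ξ.incl.rotate γ := by
  obtain ⟨γ, hγ⟩ := OrthGroup.exists_extend
    (η.1ᗮ.subtypeₗᵢ.comp (Unitary.linearIsometryEquiv δ).toLinearIsometry)
  have h (ξ : LinGrass j η.1ᗮ) : (ξ.rotate δ).incl = ξ.incl.rotate γ := by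
    refine LinGrass.ext (SetLike.coe_injective ?_)
    change _ '' (_ '' _) = _ '' (_ '' _)
    rw [Set.image_image, Set.image_image]
    exact Set.image_congr fun x _ => (hγ x).symm
  refine ⟨γ, LinGrass.ext ?_, h⟩
  rw [← Submodule.orthogonal_orthogonal (η.rotate γ).1, LinGrass.orthogonal_rotate]
  nth_rw 2 [← Submodule.orthogonal_orthogonal η.1]
  congr 1
  refine SetLike.coe_injective (Set.Subset.antisymm ?_ fun y hy => ?_)
  · rintro _ ⟨x, hx, rfl⟩
    change (γ : V →L[ℝ] V) x ∈ η.1ᗮ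
    rw [hγ ⟨x, hx⟩]
    exact Subtype.prop _
  · refine ⟨(Unitary.linearIsometryEquiv δ).symm ⟨y, hy⟩, Subtype.prop _, (hγ _).trans ?_⟩
    simp

theorem LinGrass.lintegral_orthogonal_rotate (η : LinGrass k V) (ξ : LinGrass j η.1ᗮ)
    (γ : OrthGroup V) {F : LinGrass j V → ℝ≥0∞} (hF : Measurable F) :
    ∫⁻ ξ' : LinGrass j (η.rotate γ).1ᗮ, F ξ'.incl ∂linGrassMeasure j (η.rotate γ).1ᗮ =
      ∫⁻ δ : OrthGroup η.1ᗮ, F ((ξ.rotate δ).incl.rotate γ) ∂orthHaar η.1ᗮ := by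
  rw [LinGrass.lintegral_incl_map _ (LinGrass.orthogonal_rotate γ η) hF,
    linGrassMeasure_eq_map ξ, lintegral_map _ (LinGrass.measurable_rotate ξ)]
  · rfl
  · exact hF.comp ((LinGrass.measurable_mapIso _).comp LinGrass.measurable_incl)

/-- The flag `(γ η, γ ξ)`, with `γ` distributed according to the Haar measure, is distributed
according to the iterated Grassmannian measures. -/
theorem LinGrass.lintegral_lintegral_orthogonal (η : LinGrass k V) (ξ : LinGrass j η.1ᗮ)
    {H : LinGrass k V × LinGrass j V → ℝ≥0∞} (hH : Measurable H) :
    ∫⁻ η' : LinGrass k V, ∫⁻ ξ' : LinGrass j η'.1ᗮ, H (η', ξ'.incl) ∂linGrassMeasure j η'.1ᗮ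
        ∂linGrassMeasure k V =
      ∫⁻ γ : OrthGroup V, H (η.rotate γ, ξ.incl.rotate γ) ∂orthHaar V := by
  have hrot (η' : LinGrass k V) := LinGrass.measurable_rotate η'
  have hval (γ : OrthGroup V) := LinGrass.lintegral_orthogonal_rotate η ξ γ
    (F := fun ξ' => H (η.rotate γ, ξ')) (hH.comp (measurable_const.prodMk measurable_id))
  have hmeas : Measurable fun q : OrthGroup V × OrthGroup η.1ᗮ =>
      H (η.rotate q.1, (ξ.rotate q.2).incl.rotate q.1) := by
    refine hH.comp (((hrot η).comp measurable_fst).prodMk ?_)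
    exact LinGrass.measurable_rotate_uncurry.comp (measurable_fst.prodMk
      (LinGrass.measurable_incl.comp ((LinGrass.measurable_rotate ξ).comp measurable_snd)))
  have hA : Measurable fun η' : LinGrass k V =>
      ∫⁻ ξ' : LinGrass j η'.1ᗮ, H (η', ξ'.incl) ∂linGrassMeasure j η'.1ᗮ := by
    -- After composing with `γ ↦ γη`, the domain of integration is the fixed group `O(ηᗮ)`, and
    -- Tonelli applies.
    rw [← Measurable.measurable_comp_iff_of_surjective (hrot η) (LinGrass.exists_rotate_eq η)]
    have h := hmeas.lintegral_prod_right' (ν := orthHaar η.1ᗮ)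
    simp only [← hval] at h
    exact h
  rw [linGrassMeasure_eq_map η, lintegral_map hA (hrot η)]
  simp only [hval]
  rw [lintegral_lintegral_swap hmeas.aemeasurable]
  -- The extension `δ'` of `δ` fixes `η`, so the substitution `γ ↦ γδ'` removes `δ`; the integral
  -- over `δ` is then that of a constant against a probability measure.
  have (δ : OrthGroup η.1ᗮ) :
      ∫⁻ γ, H (η.rotate γ, (ξ.rotate δ).incl.rotate γ) ∂orthHaar V =
        ∫⁻ γ, H (η.rotate γ, ξ.incl.rotate γ) ∂orthHaar V := by
    obtain ⟨δ', h1, h2⟩ := LinGrass.exists_rotate_incl (j := j) η δ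
    refine Eq.trans ?_ (lintegral_mul_right_eq_self _ δ')
    simp only [LinGrass.rotate_mul, h1, h2]
  simp [this]

end Flags

/-! ### Duality of the two transforms. -/

noncomputable section Duality

variable {j k : ℕ} {V : Type*} [NormedAddCommGroup V] [InnerProductSpace ℝ V]
  [FiniteDimensional ℝ V] [CompleteSpace V] [MeasurableSpace V] [BorelSpace V]

theorem LinGrass.plane_eq_iff {ξ : LinGrass j V} {x y : V} :
    ξ.plane x = ξ.plane y ↔ x - y ∈ ξ.1 := by
  constructor
  · intro h
    have hx : x ∈ (ξ.plane x).1 := AffineSubspace.self_mem_mk' x ξ.1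
    rw [h] at hx
    simpa using (AffineSubspace.mem_mk' (p := y) (direction := ξ.1)).1 hx
  · intro h
    refine AffGrass.ext (AffineSubspace.ext_of_direction_eq ?_ ⟨x, ?_, ?_⟩)
    · exact (AffineSubspace.direction_mk' x ξ.1).trans (AffineSubspace.direction_mk' y ξ.1).symm
    · exact AffineSubspace.self_mem_mk' x ξ.1
    · exact (AffineSubspace.mem_mk' (p := y) (direction := ξ.1)).2 (by simpa using h)

theorem AffGrass.measurable_dir : Measurable (AffGrass.dir : AffGrass j V → LinGrass j V) := by
  have : Measurable fun τ : AffGrass j V => (τ.dir, τ.foot) := fun t ht => ⟨t, ht, rfl⟩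
  exact measurable_fst.comp this

theorem AffGrass.measurable_foot : Measurable (AffGrass.foot : AffGrass j V → V) := by
  have : Measurable fun τ : AffGrass j V => (τ.dir, τ.foot) := fun t ht => ⟨t, ht, rfl⟩
  exact measurable_snd.comp this

theorem LinGrass.measurable_plane_comp {α : Type*} [MeasurableSpace α] {f : α → LinGrass j V}
    {g : α → V} (hf : Measurable f) (hg : Measurable g) : Measurable fun a => (f a).plane (g a) :=
  LinGrass.measurable_plane.comp (hf.prodMk hg)

instance LinGrass.instCountablySeparatedProd :
    MeasurableSpace.CountablySeparated (LinGrass j V × V) :=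
  .of_injective (f := fun q => (q.1.1.starProjection, q.2))
    ((LinGrass.measurable_starProjection.comp measurable_fst).prodMk measurable_snd)
    fun _ _ h => Prod.ext (LinGrass.ext (Submodule.starProjection_inj.1 (Prod.ext_iff.1 h).1))
      (Prod.ext_iff.1 h).2

/-- The value of the mixed Radon transform at the plane `η + v`, `v ∈ ηᗮ`. -/
def mixedRadonAt (F : AffGrass j V → ℝ≥0∞) (η : LinGrass k V) (v : V) : ℝ≥0∞ :=
  ∫⁻ ξ : LinGrass j η.1ᗮ, (∫⁻ u : η.1, F (ξ.incl.plane ((u : V) + v))) ∂linGrassMeasure j η.1ᗮ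

theorem LinGrass.measurable_incl_plane {U : Submodule ℝ V} (v : V) :
    Measurable fun q : LinGrass j Uᗮ × U => q.1.incl.plane ((q.2 : V) + v) :=
  LinGrass.measurable_plane.comp ((LinGrass.measurable_incl.comp measurable_fst).prodMk
    ((measurable_subtype_coe.comp measurable_snd).add_const v))

theorem mixedRadon_eq_mixedRadonAt {F : AffGrass j V → ℝ≥0∞} (hF : Measurable F)
    (ζ : AffGrass k V) : mixedRadon j F ζ = mixedRadonAt F ζ.dir ζ.foot := by
  rw [mixedRadon, perpMeasure, lintegral_map hF (LinGrass.measurable_incl_plane _)]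
  exact lintegral_prod _ (hF.comp (LinGrass.measurable_incl_plane _)).aemeasurable

theorem lintegral_rotate (γ : OrthGroup V) (η : LinGrass k V) {g : V → ℝ≥0∞} (hg : Measurable g) :
    ∫⁻ u : (η.rotate γ).1, g u = ∫⁻ u : η.1, g ((γ : V →L[ℝ] V) u) := by
  let e : η.1 ≃ₗᵢ[ℝ] (η.rotate γ).1 := (Unitary.linearIsometryEquiv γ).submoduleMap η.1
  exact (e.measurePreserving.lintegral_comp (hg.comp measurable_subtype_coe)).symm

/-- Both inner domains move with the subspace. Over `O(V) × V` they become the fixed spaces `O(ηᗮ)`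
and `η`, and measurability descends along the surjection. -/
theorem measurable_mixedRadonAt (η : LinGrass k V) (ξ : LinGrass j η.1ᗮ)
    {F : AffGrass j V → ℝ≥0∞} (hF : Measurable F) :
    Measurable fun q : LinGrass k V × V => mixedRadonAt F q.1 q.2 := by
  have hs : Function.Surjective (Prod.map (fun γ : OrthGroup V => η.rotate γ) (id : V → V)) :=
    Function.Surjective.prodMap (LinGrass.exists_rotate_eq η) Function.surjective_id
  rw [← Measurable.measurable_comp_iff_of_surjective
    ((LinGrass.measurable_rotate η).prodMap measurable_id) hs]
  have hmeas : Measurable fun q : ((OrthGroup V × V) × OrthGroup η.1ᗮ) × η.1 =>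
      F (((ξ.rotate q.1.2).incl.rotate q.1.1.1).plane
        ((q.1.1.1 : V →L[ℝ] V) q.2 + q.1.1.2)) := by
    refine hF.comp (LinGrass.measurable_plane.comp (Measurable.prodMk ?_ ?_))
    · exact LinGrass.measurable_rotate_uncurry.comp ((by fun_prop : Measurable
        fun q : ((OrthGroup V × V) × OrthGroup η.1ᗮ) × η.1 => q.1.1.1).prodMk
          (LinGrass.measurable_incl.comp ((LinGrass.measurable_rotate ξ).comp (by fun_prop))))
    · have hc : Continuous fun q : ((OrthGroup V × V) × OrthGroup η.1ᗮ) × η.1 =>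
        (q.1.1.1 : V →L[ℝ] V) q.2 + q.1.1.2 := by fun_prop
      exact hc.measurable
  have hval : (fun q : LinGrass k V × V => mixedRadonAt F q.1 q.2) ∘
      Prod.map (fun γ : OrthGroup V => η.rotate γ) (id : V → V) = fun q =>
      ∫⁻ δ : OrthGroup η.1ᗮ, (∫⁻ u : η.1, F (((ξ.rotate δ).incl.rotate q.1).plane
        ((q.1 : V →L[ℝ] V) u + q.2))) ∂orthHaar η.1ᗮ := by
    funext q
    have hm : Measurable fun p : LinGrass j V × (η.rotate q.1).1 =>
        F (p.1.plane ((p.2 : V) + q.2)) :=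
      hF.comp (LinGrass.measurable_plane_comp (by fun_prop) (by fun_prop))
    refine (LinGrass.lintegral_orthogonal_rotate η ξ q.1 hm.lintegral_prod_right').trans ?_
    refine lintegral_congr fun δ => ?_
    exact lintegral_rotate q.1 η (g := fun u => F (LinGrass.plane _ (u + q.2)))
      (hF.comp (LinGrass.measurable_plane_comp (by fun_prop) (by fun_prop)))
  rw [hval]
  have h1 : Measurable fun q : (OrthGroup V × V) × OrthGroup η.1ᗮ =>
      ∫⁻ u : η.1, F (((ξ.rotate q.2).incl.rotate q.1.1).plane ((q.1.1 : V →L[ℝ] V) u + q.1.2)) :=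
    hmeas.lintegral_prod_right' (ν := (volume : Measure η.1))
  exact h1.lintegral_prod_right' (ν := orthHaar η.1ᗮ)

theorem measurable_mixedRadon (η : LinGrass k V) (ξ : LinGrass j η.1ᗮ)
    {F : AffGrass j V → ℝ≥0∞} (hF : Measurable F) :
    Measurable fun ζ : AffGrass k V => mixedRadon j F ζ := by
  simp only [mixedRadon_eq_mixedRadonAt hF]
  exact Measurable.comp (g := fun q : LinGrass k V × V => mixedRadonAt F q.1 q.2)
    (f := fun ζ : AffGrass k V => (ζ.dir, ζ.foot)) (measurable_mixedRadonAt η ξ hF)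
    (AffGrass.measurable_dir.prodMk AffGrass.measurable_foot)

theorem lintegral_orthogonal_prod (U : Submodule ℝ V) {g : V → ℝ≥0∞} (hg : Measurable g) :
    ∫⁻ v : Uᗮ, ∫⁻ u : U, g ((u : V) + v) = ∫⁻ x, g x := by
  have hmp := U.measurePreserving_measurableEquivProd (0 : V)
  rw [InnerProductSpace.euclideanHausdorffMeasure_eq_volume] at hmp
  have h := hmp.symm.lintegral_comp hg
  simp only [Submodule.measurableEquivProd_symm_apply, vadd_eq_add, add_zero] at h
  rw [← h, Measure.volume_eq_prod, lintegral_prod_symm']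
  fun_prop

theorem lintegral_affGrassMeasure {F : AffGrass j V → ℝ≥0∞} (hF : Measurable F) :
    ∫⁻ τ, F τ ∂affGrassMeasure j V =
      ∫⁻ ξ : LinGrass j V, (∫⁻ u : ξ.1ᗮ, F (ξ.plane u)) ∂linGrassMeasure j V := by
  rw [affGrassMeasure, Measure.lintegral_bind LinGrass.measurable_fibreMeasure.aemeasurable
    hF.aemeasurable]
  refine lintegral_congr fun ξ => lintegral_map hF ?_
  exact LinGrass.measurable_plane.comp (measurable_const.prodMk measurable_subtype_coe)

/-- Since `φ(η' + v)` does not change when `v` moves along `η'`, it can be taken under the integral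
over `u ∈ η'`. Then `u` and `v` combine into one Lebesgue integral over `V`, and the iterated
Grassmannian integral becomes an integral over `O(V)`. -/
theorem lintegral_mul_mixedRadon (η : LinGrass k V) (ξ : LinGrass j η.1ᗮ)
    {F : AffGrass j V → ℝ≥0∞} (hF : Measurable F) {φ : AffGrass k V → ℝ≥0∞} (hφ : Measurable φ) :
    ∫⁻ ζ, φ ζ * mixedRadon j F ζ ∂affGrassMeasure k V =
      ∫⁻ γ : OrthGroup V, (∫⁻ x : V, φ ((η.rotate γ).plane x) * F ((ξ.incl.rotate γ).plane x))
        ∂orthHaar V := by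
  have hH : Measurable fun q : (LinGrass k V × LinGrass j V) × V =>
      φ (q.1.1.plane q.2) * F (q.1.2.plane q.2) :=
    (hφ.comp (LinGrass.measurable_plane_comp (by fun_prop) (by fun_prop))).mul
      (hF.comp (LinGrass.measurable_plane_comp (by fun_prop) (by fun_prop)))
  refine Eq.trans ?_ (LinGrass.lintegral_lintegral_orthogonal η ξ hH.lintegral_prod_right')
  refine (lintegral_affGrassMeasure (hφ.mul (measurable_mixedRadon η ξ hF))).trans ?_
  simp only [Pi.mul_apply]
  refine lintegral_congr fun η' => ?_
  have hval (v : η'.1ᗮ) : φ (η'.plane v) * mixedRadon j F (η'.plane v) =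
      ∫⁻ ξ' : LinGrass j η'.1ᗮ, (∫⁻ u : η'.1, φ (η'.plane ((u : V) + v)) *
        F (ξ'.incl.plane ((u : V) + v))) ∂linGrassMeasure j η'.1ᗮ := by
    have hfoot : (η'.plane (v : V)).foot = v := by
      rw [LinGrass.foot_plane]
      exact Submodule.starProjection_eq_self_iff.2 v.2
    have hpl (u : η'.1) : η'.plane ((u : V) + v) = η'.plane v :=
      LinGrass.plane_eq_iff.2 (by simp)
    have hm : Measurable fun q : LinGrass j η'.1ᗮ × η'.1 => F (q.1.incl.plane ((q.2 : V) + v)) :=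
      hF.comp (LinGrass.measurable_incl_plane (v : V))
    rw [mixedRadon_eq_mixedRadonAt hF, LinGrass.dir_plane, hfoot, mixedRadonAt]
    simp only [hpl]
    rw [← lintegral_const_mul _ hm.lintegral_prod_right']
    refine lintegral_congr fun ξ' => (lintegral_const_mul _ ?_).symm
    exact hm.comp measurable_prodMk_left
  simp only [hval]
  have hpair : Measurable fun q : (η'.1ᗮ × LinGrass j η'.1ᗮ) × η'.1 =>
      φ (η'.plane ((q.2 : V) + q.1.1)) * F (q.1.2.incl.plane ((q.2 : V) + q.1.1)) := by
    refine hH.comp (Measurable.prodMk (measurable_const.prodMk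
      (LinGrass.measurable_incl.comp (by fun_prop))) (by fun_prop))
  -- Moving `ξ'` outermost leaves the integrals over `η'ᗮ` and `η'` adjacent.
  rw [lintegral_lintegral_swap hpair.lintegral_prod_right'.aemeasurable]
  refine lintegral_congr fun ξ' => ?_
  exact lintegral_orthogonal_prod η'.1 (g := fun x => φ (η'.plane x) * F (ξ'.incl.plane x))
    (hH.comp (measurable_prodMk_left (x := (η', ξ'.incl))))

theorem LinGrass.exists_incl_eq {U : Submodule ℝ V} (ξ : LinGrass j V) (h : ξ.1 ≤ U) :
    ∃ ξ' : LinGrass j U, ξ'.incl = ξ := by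
  refine ⟨⟨ξ.1.comap U.subtype, ?_⟩, LinGrass.ext ?_⟩
  · rw [← U.finrank_map_subtype_eq, Submodule.map_comap_subtype, inf_eq_right.2 h, ξ.2]
  · change (ξ.1.comap U.subtype).map U.subtype = ξ.1
    rw [Submodule.map_comap_subtype, inf_eq_right.2 h]

theorem LinGrass.incl_le {U : Submodule ℝ V} (ξ : LinGrass j U) : ξ.incl.1 ≤ U :=
  Submodule.map_subtype_le U ξ.1

/-- The mixed Radon transforms `R_{j,k}` and `R_{k,j}` are dual to each other. -/
theorem lintegral_mul_mixedRadon_comm (η : LinGrass k V) (ξ : LinGrass j η.1ᗮ)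
    {F : AffGrass j V → ℝ≥0∞} (hF : Measurable F) {φ : AffGrass k V → ℝ≥0∞} (hφ : Measurable φ) :
    ∫⁻ ζ, φ ζ * mixedRadon j F ζ ∂affGrassMeasure k V =
      ∫⁻ τ, F τ * mixedRadon k φ τ ∂affGrassMeasure j V := by
  -- Orthogonality is symmetric: `η` lies in the complement of `ξ`, so the same pair computes the
  -- other side.
  obtain ⟨η', hη'⟩ := LinGrass.exists_incl_eq (U := ξ.incl.1ᗮ) η
    ((Submodule.le_orthogonal_iff_le_orthogonal).1 ξ.incl_le)
  rw [lintegral_mul_mixedRadon η ξ hF hφ, lintegral_mul_mixedRadon ξ.incl η' hφ hF, hη']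
  simp only [mul_comm]

end Duality

/-! ### Decay of the transform of the indicator of planes near the origin. -/

noncomputable section Estimates

/-- The volume of the unit ball of the `d`-dimensional Euclidean space. -/
def unitBallVolume (d : ℕ) : ℝ≥0∞ := volume (Metric.ball (0 : EuclideanSpace ℝ (Fin d)) 1)

theorem unitBallVolume_ne_zero (d : ℕ) : unitBallVolume d ≠ 0 :=
  (Metric.measure_ball_pos _ _ one_pos).ne'

theorem unitBallVolume_ne_top (d : ℕ) : unitBallVolume d ≠ ∞ := measure_ball_lt_top.ne

section Balls

variable {E : Type*} [NormedAddCommGroup E] [InnerProductSpace ℝ E] [FiniteDimensional ℝ E]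
  [MeasurableSpace E] [BorelSpace E] {d : ℕ}

theorem exists_linearIsometryEquiv_euclideanSpace (hd : finrank ℝ E = d) :
    Nonempty (E ≃ₗᵢ[ℝ] EuclideanSpace ℝ (Fin d)) :=
  ⟨((stdOrthonormalBasis ℝ E).reindex (finCongr hd)).repr⟩

theorem lintegral_fun_norm_eq (hd : finrank ℝ E = d) {w : ℝ → ℝ≥0∞} (hw : Measurable w) :
    ∫⁻ x : E, w ‖x‖ = ∫⁻ x : EuclideanSpace ℝ (Fin d), w ‖x‖ := by
  obtain ⟨e⟩ := exists_linearIsometryEquiv_euclideanSpace hd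
  have h := e.measurePreserving.lintegral_comp (hw.comp measurable_norm)
  simpa using h

theorem volume_ball_eq_unitBallVolume (hd : finrank ℝ E = d) {r : ℝ} (hr : 0 < r) :
    volume (Metric.ball (0 : E) r) = ENNReal.ofReal r ^ d * unitBallVolume d := by
  obtain ⟨e⟩ := exists_linearIsometryEquiv_euclideanSpace hd
  rw [Measure.addHaar_ball_of_pos _ _ hr, hd, ENNReal.ofReal_pow hr.le, unitBallVolume,
    ← e.measurePreserving.measure_preimage measurableSet_ball.nullMeasurableSet]
  simp

end Balls

variable {j k l : ℕ} {V : Type*} [NormedAddCommGroup V] [InnerProductSpace ℝ V]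
  [FiniteDimensional ℝ V] [CompleteSpace V] [MeasurableSpace V] [BorelSpace V]

theorem LinGrass.finrank_orthogonal (η : LinGrass k V) (h : finrank ℝ V = k + l) :
    finrank ℝ η.1ᗮ = l := by
  have := η.1.finrank_add_finrank_orthogonal
  have := η.2
  lia

theorem LinGrass.measurable_norm_sub_starProjection :
    Measurable fun q : LinGrass k V × V => ‖q.2 - q.1.1.starProjection q.2‖ := by
  have hc : Continuous fun q : (V →L[ℝ] V) × V => ‖q.2 - q.1 q.2‖ := by fun_prop
  exact hc.measurable.comp
    ((LinGrass.measurable_starProjection.comp measurable_fst).prodMk measurable_snd)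

/-- Shrink `u` to the norm of `u'`, which does not increase its distance to any subspace, then
reflect it onto `u'`; the measure is invariant under the reflection. -/
theorem linGrassMeasure_dist_lt_anti {u u' : V} (h : ‖u'‖ ≤ ‖u‖) (R : ℝ) :
    linGrassMeasure k V {η | ‖u - η.1.starProjection u‖ < R} ≤
      linGrassMeasure k V {η | ‖u' - η.1.starProjection u'‖ < R} := by
  obtain ⟨c, hc0, hc1, hc⟩ : ∃ c : ℝ, 0 ≤ c ∧ c ≤ 1 ∧ ‖c • u‖ = ‖u'‖ := by
    refine ⟨‖u'‖ / ‖u‖, by positivity, div_le_one_of_le₀ h (norm_nonneg _), ?_⟩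
    rcases eq_or_ne ‖u‖ 0 with h0 | h0
    · have : ‖u'‖ = 0 := le_antisymm (h.trans h0.le) (norm_nonneg _)
      simp [h0, this]
    · rw [norm_smul, norm_div, norm_norm, norm_norm, div_mul_cancel₀ _ h0]
  let δ : V ≃ₗᵢ[ℝ] V := (Submodule.span ℝ {c • u - u'})ᗮ.reflection
  have hδ : δ (c • u) = u' := Submodule.reflection_sub hc
  have hm : MeasurableSet {η : LinGrass k V | ‖u' - η.1.starProjection u'‖ < R} :=
    measurableSet_lt (LinGrass.measurable_norm_sub_starProjection.comp measurable_prodMk_right)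
      measurable_const
  rw [← (LinGrass.measurePreserving_mapIso δ).measure_preimage hm.nullMeasurableSet]
  refine measure_mono fun η hη => ?_
  have : u' - (η.mapIso δ).1.starProjection u' = δ (c • (u - η.1.starProjection u)) := by
    rw [LinGrass.starProjection_mapIso, ← hδ]
    simp [smul_sub]
  change ‖u' - (η.mapIso δ).1.starProjection u'‖ < R
  rw [this, δ.norm_map, norm_smul, Real.norm_of_nonneg hc0]
  exact (mul_le_of_le_one_left (norm_nonneg _) hc1).trans_lt hη

/-- An averaging argument replaces the exact law of the distance. By monotonicity the probability at
`u` is at most that at any point of the ball of radius `‖u‖`. Integrating over the ball and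
exchanging integrals leaves, for each `η`, the volume of part of a ball in `η` of radius `‖u‖` times
a ball in `ηᗮ` of radius `R`. -/
theorem linGrassMeasure_dist_lt_mul_le (hV : finrank ℝ V = k + l) {R : ℝ} (hR : 0 < R) {u : V}
    (hu : u ≠ 0) :
    linGrassMeasure k V {η | ‖u - η.1.starProjection u‖ < R} *
        (ENNReal.ofReal ‖u‖ ^ (k + l) * unitBallVolume (k + l)) ≤
      ENNReal.ofReal ‖u‖ ^ k * unitBallVolume k * (ENNReal.ofReal R ^ l * unitBallVolume l) := by
  have hr : 0 < ‖u‖ := norm_pos_iff.2 hu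
  set S : Set (LinGrass k V × V) :=
    {q | ‖q.2‖ < ‖u‖ ∧ ‖q.2 - q.1.1.starProjection q.2‖ < R} with hS
  have hSm : MeasurableSet S := (measurableSet_lt measurable_snd.norm measurable_const).inter
    (measurableSet_lt LinGrass.measurable_norm_sub_starProjection measurable_const)
  rw [← volume_ball_eq_unitBallVolume hV hr]
  calc linGrassMeasure k V {η | ‖u - η.1.starProjection u‖ < R} * volume (Metric.ball (0 : V) ‖u‖)
      = ∫⁻ _ in Metric.ball (0 : V) ‖u‖,
          linGrassMeasure k V {η | ‖u - η.1.starProjection u‖ < R} := by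
        rw [setLIntegral_const]
    _ ≤ ∫⁻ x in Metric.ball (0 : V) ‖u‖, linGrassMeasure k V ((fun η => (η, x)) ⁻¹' S) := by
        refine setLIntegral_mono' measurableSet_ball fun x hx => ?_
        rw [mem_ball_zero_iff] at hx
        refine (linGrassMeasure_dist_lt_anti hx.le R).trans (measure_mono fun η hη => ⟨hx, hη⟩)
    _ ≤ ∫⁻ x, linGrassMeasure k V ((fun η => (η, x)) ⁻¹' S) := setLIntegral_le_lintegral _ _
    _ = ∫⁻ η, volume (Prod.mk η ⁻¹' S) ∂linGrassMeasure k V := by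
        rw [← Measure.prod_apply_symm hSm, Measure.prod_apply hSm]
    _ ≤ ∫⁻ _, ENNReal.ofReal ‖u‖ ^ k * unitBallVolume k *
          (ENNReal.ofReal R ^ l * unitBallVolume l) ∂linGrassMeasure k V := by
        refine lintegral_mono fun η => ?_
        have hmp := η.1.measurePreserving_measurableEquivProd (0 : V)
        rw [InnerProductSpace.euclideanHausdorffMeasure_eq_volume] at hmp
        rw [← volume_ball_eq_unitBallVolume η.2 hr,
          ← volume_ball_eq_unitBallVolume (η.finrank_orthogonal hV) hR, ← Measure.prod_prod,
          ← Measure.volume_eq_prod, ← hmp.measure_preimage_equiv]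
        refine measure_mono fun x hx => ?_
        have h1 : ‖η.1.starProjection x‖ < ‖u‖ :=
          (η.1.norm_starProjection_apply_le x).trans_lt hx.1
        have h2 : ‖η.1ᗮ.starProjection x‖ < R := by
          rw [Submodule.starProjection_orthogonal']
          exact hx.2
        simp only [Set.mem_preimage, Set.mem_prod, mem_ball_zero_iff,
          Submodule.measurableEquivProd_apply, vsub_eq_sub, sub_zero]
        exact ⟨h1, h2⟩
    _ ≤ _ := by
        rw [lintegral_const]
        exact mul_le_of_le_one_right' linGrassMeasure_univ_le_one

/-- The constant in the decay estimate `linGrassMeasure_dist_lt_mul_one_add_pow_le`. -/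
def decayConst (k l : ℕ) (R : ℝ) : ℝ≥0∞ :=
  2 ^ l * (1 + unitBallVolume k * (ENNReal.ofReal R ^ l * unitBallVolume l) /
    unitBallVolume (k + l))

theorem decayConst_ne_top (k l : ℕ) (R : ℝ) : decayConst k l R ≠ ∞ := by
  refine ENNReal.mul_ne_top (by simp) (ENNReal.add_ne_top.2 ⟨by simp, ?_⟩)
  refine ENNReal.div_ne_top ?_ (unitBallVolume_ne_zero _)
  exact ENNReal.mul_ne_top (unitBallVolume_ne_top _)
    (ENNReal.mul_ne_top (by simp) (unitBallVolume_ne_top _))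

theorem linGrassMeasure_dist_lt_mul_one_add_pow_le (hV : finrank ℝ V = k + l) {R : ℝ}
    (hR : 0 < R) (u : V) :
    linGrassMeasure k V {η | ‖u - η.1.starProjection u‖ < R} * ENNReal.ofReal (1 + ‖u‖) ^ l ≤
      decayConst k l R := by
  set h := linGrassMeasure k V {η | ‖u - η.1.starProjection u‖ < R} with hh
  have h1 : h ≤ 1 := (measure_mono (Set.subset_univ _)).trans linGrassMeasure_univ_le_one
  rcases lt_or_ge ‖u‖ 1 with hu | hu
  · have : ENNReal.ofReal (1 + ‖u‖) ≤ 2 := by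
      rw [← ENNReal.ofReal_ofNat]
      exact ENNReal.ofReal_le_ofReal (by linarith)
    calc h * ENNReal.ofReal (1 + ‖u‖) ^ l ≤ 1 * 2 ^ l := by gcongr
      _ ≤ decayConst k l R := by
        rw [decayConst, mul_comm]
        gcongr
        exact le_self_add
  · have hu0 : u ≠ 0 := by
      rintro rfl
      simp at hu
      linarith
    have h2 : ENNReal.ofReal (1 + ‖u‖) ≤ 2 * ENNReal.ofReal ‖u‖ := by
      rw [← ENNReal.ofReal_ofNat, ← ENNReal.ofReal_mul (by norm_num)]
      exact ENNReal.ofReal_le_ofReal (by linarith)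
    have hk0 : ENNReal.ofReal ‖u‖ ^ k ≠ 0 := pow_ne_zero _ (by simpa using hu0)
    have hkt : ENNReal.ofReal ‖u‖ ^ k ≠ ∞ := by simp
    -- Cancelling `‖u‖ ^ k` in the averaged inequality leaves the exponent `l`.
    have h3 : h * ENNReal.ofReal ‖u‖ ^ l ≤ unitBallVolume k *
        (ENNReal.ofReal R ^ l * unitBallVolume l) / unitBallVolume (k + l) := by
      rw [ENNReal.le_div_iff_mul_le (.inl (unitBallVolume_ne_zero _))
        (.inl (unitBallVolume_ne_top _)), ← ENNReal.mul_le_mul_iff_right hk0 hkt]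
      convert linGrassMeasure_dist_lt_mul_le hV hR hu0 using 1
      · rw [← hh, pow_add]; ring
      · ring
    calc h * ENNReal.ofReal (1 + ‖u‖) ^ l ≤ h * (2 * ENNReal.ofReal ‖u‖) ^ l := by gcongr
      _ = 2 ^ l * (h * ENNReal.ofReal ‖u‖ ^ l) := by rw [mul_pow]; ring
      _ ≤ decayConst k l R := by
        rw [decayConst]
        gcongr
        exact h3.trans le_add_self

theorem LinGrass.starProjection_incl {U : Submodule ℝ V} (ξ : LinGrass j U) (x : V) :
    ξ.incl.1.starProjection x = (ξ.1.starProjection (U.orthogonalProjectionOnto x) : U) := by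
  refine Submodule.eq_starProjection_of_mem_of_inner_eq_zero (K := ξ.1.map U.subtype)
    (Submodule.mem_map_of_mem (Submodule.starProjection_apply_mem _ _)) ?_
  rintro _ ⟨w, hw, rfl⟩
  have h1 := ξ.1.starProjection_inner_eq_zero (U.orthogonalProjectionOnto x) w hw
  have h2 := U.starProjection_inner_eq_zero x (w : V) w.2
  rw [Submodule.coe_inner, Submodule.coe_sub, inner_sub_left] at h1
  rw [inner_sub_left] at h2
  change inner ℝ (x - _) (w : V) = 0
  rw [inner_sub_left]
  rw [Submodule.starProjection_apply] at h2
  linarith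

theorem AffGrass.foot_mem (τ : AffGrass j V) : τ.foot ∈ τ.dir.1ᗮ :=
  Submodule.starProjection_apply_mem _ _

/-- The two summands lie in `ξ` and `ξᗮ`, so by Pythagoras a bound on the foot bounds each of them.
-/
theorem LinGrass.foot_incl_plane {ξ : LinGrass j V} (η : LinGrass k ξ.1ᗮ) (v : ξ.1) (u : ξ.1ᗮ) :
    (η.incl.plane ((v : V) + u)).foot = v + ((u - η.1.starProjection u : ξ.1ᗮ) : V) := by
  have : ξ.1ᗮ.orthogonalProjectionOnto ((v : V) + u) = u := by
    rw [map_add, Submodule.orthogonalProjectionOnto_mem_subspace_eq_self,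
      Submodule.orthogonalProjectionOnto_eq_zero_iff.2, zero_add]
    exact Submodule.le_orthogonal_orthogonal _ v.2
  rw [LinGrass.foot_plane, Submodule.starProjection_orthogonal']
  change (v : V) + u - η.incl.1.starProjection _ = _
  rw [LinGrass.starProjection_incl, this]
  simp [add_sub_assoc]

/-- The characteristic function of the set of planes at distance less than `R` from the origin. -/
def nearIndicator (R : ℝ) : AffGrass k V → ℝ≥0∞ :=
  Set.indicator {ζ | ‖ζ.foot‖ < R} 1

theorem measurable_nearIndicator (R : ℝ) :
    Measurable (nearIndicator R : AffGrass k V → ℝ≥0∞) :=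
  measurable_one.indicator (measurableSet_lt AffGrass.measurable_foot.norm measurable_const)

theorem mixedRadon_nearIndicator_mul_le (hV : finrank ℝ V = j + (k + l)) {R : ℝ} (hR : 0 < R)
    (τ : AffGrass j V) :
    mixedRadon k (nearIndicator R) τ * ENNReal.ofReal (1 + ‖τ.foot‖) ^ l ≤
      ENNReal.ofReal R ^ j * unitBallVolume j * decayConst k l R := by
  rw [mixedRadon_eq_mixedRadonAt (measurable_nearIndicator R)]
  set u : τ.dir.1ᗮ := ⟨τ.foot, τ.foot_mem⟩ with hu
  set A : Set (LinGrass k τ.dir.1ᗮ) := {η | ‖u - η.1.starProjection u‖ < R} with hA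
  have hAm : MeasurableSet A := measurableSet_lt
    (LinGrass.measurable_norm_sub_starProjection.comp measurable_prodMk_right) measurable_const
  have h1 : mixedRadonAt (nearIndicator R : AffGrass k V → ℝ≥0∞) τ.dir τ.foot ≤
      ENNReal.ofReal R ^ j * unitBallVolume j * linGrassMeasure k τ.dir.1ᗮ A := by
    calc mixedRadonAt (nearIndicator R : AffGrass k V → ℝ≥0∞) τ.dir τ.foot
        ≤ ∫⁻ η : LinGrass k τ.dir.1ᗮ, (∫⁻ v : τ.dir.1, A.indicator 1 η *
            (Metric.ball (0 : τ.dir.1) R).indicator 1 v) ∂linGrassMeasure k τ.dir.1ᗮ := by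
          refine lintegral_mono fun η => lintegral_mono fun v => ?_
          refine Set.indicator_apply_le' (fun h => ?_) fun _ => zero_le
          change ‖(η.incl.plane ((v : V) + u)).foot‖ < R at h
          rw [LinGrass.foot_incl_plane] at h
          have horth : inner ℝ (v : V) ((u - η.1.starProjection u : τ.dir.1ᗮ) : V) = 0 :=
            Submodule.inner_right_of_mem_orthogonal v.2 (Subtype.prop _)
          have hsq := norm_add_sq_eq_norm_sq_add_norm_sq_of_inner_eq_zero _ _ horth
          have hv : ‖v‖ < R := by
            refine lt_of_le_of_lt ?_ h
            refine (sq_le_sq₀ (norm_nonneg _) (norm_nonneg _)).1 ?_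
            rw [Submodule.coe_norm]
            nlinarith [sq_nonneg ‖((u - η.1.starProjection u : τ.dir.1ᗮ) : V)‖]
          have hη : ‖u - η.1.starProjection u‖ < R := by
            refine lt_of_le_of_lt ?_ h
            refine (sq_le_sq₀ (norm_nonneg _) (norm_nonneg _)).1 ?_
            rw [Submodule.coe_norm]
            nlinarith [sq_nonneg ‖(v : V)‖]
          rw [Set.indicator_of_mem (show η ∈ A from hη),
            Set.indicator_of_mem (mem_ball_zero_iff.2 hv)]
          simp
      _ = _ := by
          have (η : LinGrass k τ.dir.1ᗮ) : ∫⁻ v : τ.dir.1, A.indicator 1 η *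
              (Metric.ball (0 : τ.dir.1) R).indicator 1 v =
              A.indicator 1 η * (ENNReal.ofReal R ^ j * unitBallVolume j) := by
            rw [lintegral_const_mul _ (measurable_one.indicator measurableSet_ball),
              lintegral_indicator_one measurableSet_ball,
              volume_ball_eq_unitBallVolume τ.dir.2 hR]
          simp only [this]
          rw [lintegral_mul_const _ (measurable_one.indicator hAm), lintegral_indicator_one hAm,
            mul_comm]
  calc _ ≤ ENNReal.ofReal R ^ j * unitBallVolume j * linGrassMeasure k τ.dir.1ᗮ A *
        ENNReal.ofReal (1 + ‖τ.foot‖) ^ l := by gcongr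
    _ = ENNReal.ofReal R ^ j * unitBallVolume j * (linGrassMeasure k τ.dir.1ᗮ A *
        ENNReal.ofReal (1 + ‖u‖) ^ l) := by rw [mul_assoc]; rfl
    _ ≤ _ := by
        gcongr
        exact linGrassMeasure_dist_lt_mul_one_add_pow_le (τ.dir.finrank_orthogonal hV) hR u

end Estimates

/-! ### Finiteness almost everywhere below the critical exponent. -/

noncomputable section Existence

variable {j k l : ℕ} {V : Type*} [NormedAddCommGroup V] [InnerProductSpace ℝ V]
  [FiniteDimensional ℝ V] [CompleteSpace V] [MeasurableSpace V] [BorelSpace V]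

theorem lintegral_fun_norm_foot_le (hV : finrank ℝ V = j + l) {w : ℝ → ℝ≥0∞} (hw : Measurable w) :
    ∫⁻ τ, w ‖τ.foot‖ ∂affGrassMeasure j V ≤ ∫⁻ x : EuclideanSpace ℝ (Fin l), w ‖x‖ := by
  refine (lintegral_affGrassMeasure (hw.comp AffGrass.measurable_foot.norm)).trans_le ?_
  have (ξ : LinGrass j V) : ∫⁻ u : ξ.1ᗮ, w ‖(ξ.plane (u : V)).foot‖ =
      ∫⁻ x : EuclideanSpace ℝ (Fin l), w ‖x‖ := by
    rw [← lintegral_fun_norm_eq (ξ.finrank_orthogonal hV) hw]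
    refine lintegral_congr fun u => ?_
    rw [LinGrass.foot_plane, Submodule.starProjection_eq_self_iff.2 u.2]
    rfl
  simp only [Function.comp_def, this]
  rw [lintegral_const]
  exact mul_le_of_le_one_right' linGrassMeasure_univ_le_one

theorem lintegral_nearIndicator_mul_mixedRadon_lt_top (hV : finrank ℝ V = j + (k + l))
    (η : LinGrass k V) (ξ : LinGrass j η.1ᗮ) {R : ℝ} (hR : 0 < R) {p : ℝ} (hp : 1 ≤ p)
    (hpk : p * k < k + l) {F : AffGrass j V → ℝ≥0∞} (hF : Measurable F)
    (hFp : ∫⁻ τ, F τ ^ p ∂affGrassMeasure j V < ∞) :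
    ∫⁻ ζ, nearIndicator R ζ * mixedRadon j F ζ ∂affGrassMeasure k V < ∞ := by
  rw [lintegral_mul_mixedRadon_comm η ξ hF (measurable_nearIndicator R)]
  set C : ℝ≥0∞ := ENNReal.ofReal R ^ j * unitBallVolume j * decayConst k l R with hC
  have hCt : C ≠ ∞ := ENNReal.mul_ne_top (ENNReal.mul_ne_top (by simp) (unitBallVolume_ne_top _))
    (decayConst_ne_top _ _ _)
  set w : ℝ → ℝ≥0∞ := fun r => (ENNReal.ofReal (1 + r) ^ l)⁻¹ with hw
  have hwm : Measurable w := by fun_prop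
  have hpos (τ : AffGrass j V) : 0 < 1 + ‖τ.foot‖ := by positivity
  have hbd (τ : AffGrass j V) : mixedRadon k (nearIndicator R) τ ≤ C * w ‖τ.foot‖ := by
    rw [hw, ← div_eq_mul_inv, ENNReal.le_div_iff_mul_le
      (.inl (pow_ne_zero _ (by simpa using hpos τ))) (.inl (by simp))]
    exact mixedRadon_nearIndicator_mul_le hV hR τ
  have hwf : Measurable fun τ : AffGrass j V => C * w ‖τ.foot‖ :=
    (hwm.comp AffGrass.measurable_foot.norm).const_mul C
  refine (lintegral_mono fun τ => mul_le_mul_right (hbd τ) (F τ)).trans_lt ?_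
  rcases hp.eq_or_lt with rfl | hp1
  -- For `p = 1` there is no finite conjugate exponent, but the weight is at most `1`.
  · simp only [ENNReal.rpow_one] at hFp
    refine (lintegral_mono (g := fun τ => F τ * C) fun τ => ?_).trans_lt ?_
    · refine mul_le_mul_right (mul_le_of_le_one_right' ?_) (F τ)
      refine ENNReal.inv_le_one.2 (one_le_pow₀ ?_)
      rw [← ENNReal.ofReal_one]
      exact ENNReal.ofReal_le_ofReal (by linarith [norm_nonneg τ.foot])
    · rw [lintegral_mul_const _ hF]
      exact ENNReal.mul_lt_top hFp hCt.lt_top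
  · set q := p.conjExponent with hq
    have hpq : p.HolderConjugate q := Real.HolderConjugate.conjExponent hp1
    refine (ENNReal.lintegral_mul_le_Lp_mul_Lq _ hpq hF.aemeasurable hwf.aemeasurable).trans_lt ?_
    refine ENNReal.mul_lt_top (ENNReal.rpow_lt_top_of_nonneg (by positivity) hFp.ne)
      (ENNReal.rpow_lt_top_of_nonneg (by have := hpq.symm.pos; positivity) (ne_of_lt ?_))
    simp only [ENNReal.mul_rpow_of_nonneg _ _ hpq.symm.nonneg]
    have hCq : C ^ q < ∞ := ENNReal.rpow_lt_top_of_nonneg hpq.symm.nonneg hCt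
    rw [lintegral_const_mul' _ _ hCq.ne]
    refine ENNReal.mul_lt_top hCq ?_
    refine (lintegral_fun_norm_foot_le hV (w := fun r => w r ^ q) (hwm.pow_const q)).trans_lt ?_
    -- With `q = p / (p - 1)`, the inequality `k + l < l q` rearranges to `p k < k + l`; this is
    -- where the critical exponent enters.
    have hdim : (finrank ℝ (EuclideanSpace ℝ (Fin (k + l))) : ℝ) < l * q := by
      rw [finrank_euclideanSpace_fin, hq, Real.conjExponent, ← mul_div_assoc,
        lt_div_iff₀ (by linarith)]
      push_cast
      nlinarith
    refine lt_of_eq_of_lt (lintegral_congr fun x => ?_)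
      (finite_integral_one_add_norm (μ := volume) hdim)
    have hx : 0 < 1 + ‖x‖ := by positivity
    rw [hw, ← ENNReal.ofReal_rpow_of_pos hx, ENNReal.rpow_neg, ENNReal.inv_rpow, ENNReal.rpow_mul,
      ENNReal.rpow_natCast]

theorem ae_mixedRadon_lt_top (hV : finrank ℝ V = j + (k + l))
    (η : LinGrass k V) (ξ : LinGrass j η.1ᗮ) {p : ℝ} (hp : 1 ≤ p)
    (hpk : p * k < k + l) {F : AffGrass j V → ℝ≥0∞} (hF : Measurable F)
    (hFp : ∫⁻ τ, F τ ^ p ∂affGrassMeasure j V < ∞) :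
    ∀ᵐ ζ ∂affGrassMeasure k V, mixedRadon j F ζ < ∞ := by
  have h : ∀ᵐ ζ ∂affGrassMeasure k V, ∀ N : ℕ,
      nearIndicator ((N : ℝ) + 1) ζ * mixedRadon j F ζ < ∞ := by
    refine ae_all_iff.2 fun N => ae_lt_top
      ((measurable_nearIndicator _).mul (measurable_mixedRadon η ξ hF)) (ne_of_lt ?_)
    exact lintegral_nearIndicator_mul_mixedRadon_lt_top hV η ξ (by positivity) hp hpk hF hFp
  filter_upwards [h] with ζ hζ
  obtain ⟨N, hN⟩ := exists_nat_gt ‖ζ.foot‖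
  have hmem : ζ ∈ {ζ : AffGrass k V | ‖ζ.foot‖ < (N : ℝ) + 1} := hN.trans (lt_add_one _)
  simpa only [nearIndicator, Set.indicator_of_mem hmem, Pi.one_apply, one_mul] using hζ N

/-- Duality against the constant `1`. It allows `f` to be replaced by a measurable representative on
almost every perpendicular family. -/
theorem ae_perpMeasure_eq_zero (η : LinGrass k V) (ξ : LinGrass j η.1ᗮ) {N : Set (AffGrass j V)}
    (hN : affGrassMeasure j V N = 0) :
    ∀ᵐ ζ ∂affGrassMeasure k V, perpMeasure j ζ N = 0 := by
  set M := toMeasurable (affGrassMeasure j V) N with hM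
  have hMm : MeasurableSet M := measurableSet_toMeasurable _ _
  have hind : Measurable (M.indicator (1 : AffGrass j V → ℝ≥0∞)) := measurable_one.indicator hMm
  have h := lintegral_mul_mixedRadon_comm η ξ hind (measurable_const (a := (1 : ℝ≥0∞)))
  have h0 : ∫⁻ τ, M.indicator 1 τ * mixedRadon k (fun _ : AffGrass k V => 1) τ
      ∂affGrassMeasure j V = 0 := by
    -- The transform of `1` may be infinite; the product still vanishes off `M` because `0 * ∞ = 0`.
    have hae : ∀ᵐ τ ∂affGrassMeasure j V, τ ∉ M := by
      rw [ae_iff]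
      simpa [hM, measure_toMeasurable] using hN
    refine (lintegral_congr_ae (hae.mono fun τ hτ => ?_)).trans lintegral_zero
    simp [hτ]
  simp only [one_mul] at h
  rw [h0, lintegral_eq_zero_iff (measurable_mixedRadon η ξ hind)] at h
  filter_upwards [h] with ζ hζ
  rw [mixedRadon, lintegral_indicator_one hMm] at hζ
  exact measure_mono_null (subset_toMeasurable _ _) hζ

theorem ae_mixedRadonFinite (hV : finrank ℝ V = j + (k + l))
    (η : LinGrass k V) (ξ : LinGrass j η.1ᗮ) {p : ℝ≥0∞} (hp : 1 ≤ p) (hpt : p ≠ ∞)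
    (hpk : p.toReal * k < k + l) {f : AffGrass j V → ℂ} (hf : MemLp f p (affGrassMeasure j V)) :
    ∀ᵐ ζ ∂affGrassMeasure k V, MixedRadonFinite j f ζ := by
  set g := hf.1.mk f with hg
  have hgm : StronglyMeasurable g := hf.1.stronglyMeasurable_mk
  have hfg : f =ᵐ[affGrassMeasure j V] g := hf.1.ae_eq_mk
  have hgp : MemLp g p (affGrassMeasure j V) := hf.ae_eq hfg
  have h1 : 1 ≤ p.toReal := by
    rw [← ENNReal.toReal_one]
    exact ENNReal.toReal_mono hpt hp
  have hfin := ae_mixedRadon_lt_top hV η ξ h1 hpk hgm.measurable.enorm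
    (lintegral_rpow_enorm_lt_top_of_eLpNorm_lt_top (by positivity) hpt hgp.2)
  filter_upwards [hfin, ae_perpMeasure_eq_zero η ξ (ae_iff.1 hfg)] with ζ hζ hζ'
  have hae : f =ᵐ[perpMeasure j ζ] g := ae_iff.2 hζ'
  refine ⟨⟨g, hgm, hae⟩, ?_⟩
  refine lt_of_eq_of_lt (lintegral_congr_ae (hae.mono fun τ hτ => ?_)) hζ
  simp only [hτ]

end Existence

/-! ### The extremal function at and above the critical exponent. -/

noncomputable section Sharpness

-- The primitive `(1 - P)⁻¹ (1 + log (1 + y)) ^ (1 - P)` tends to `0` because `P > 1`.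
open Filter Topology in
theorem integrableOn_inv_mul_log_rpow {P : ℝ} (hP : 1 < P) :
    IntegrableOn (fun y : ℝ => (1 + y)⁻¹ * (1 + Real.log (1 + y)) ^ (-P)) (Set.Ioi 0) := by
  have hlog {y : ℝ} (hy : 0 ≤ y) : 0 < 1 + Real.log (1 + y) := by
    have := Real.log_nonneg (show 1 ≤ 1 + y by linarith)
    linarith
  have hd {y : ℝ} (hy : 0 ≤ y) : HasDerivAt
      (fun y : ℝ => (1 - P)⁻¹ * (1 + Real.log (1 + y)) ^ (1 - P))
      ((1 + y)⁻¹ * (1 + Real.log (1 + y)) ^ (-P)) y := by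
    have h1 : HasDerivAt (fun y : ℝ => 1 + Real.log (1 + y)) ((1 + y)⁻¹) y := by
      simpa using (((hasDerivAt_id y).const_add 1).log (by simp; linarith)).const_add 1
    have h2 := (h1.rpow_const (p := 1 - P) (.inl (hlog hy).ne')).const_mul (1 - P)⁻¹
    refine h2.congr_deriv ?_
    have : 1 - P ≠ 0 := by linarith
    rw [show 1 - P - 1 = -P by ring]
    field_simp
  refine integrableOn_Ioi_deriv_of_nonneg (l := (1 - P)⁻¹ * 0)
    (hd le_rfl).continuousAt.continuousWithinAt (fun y hy => hd (le_of_lt hy)) (fun y hy => ?_) ?_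
  · have := hlog (le_of_lt hy)
    have : 0 < 1 + y := by have : 0 < y := hy; linarith
    positivity
  · refine Tendsto.const_mul _ ?_
    have ht : Tendsto (fun y : ℝ => 1 + Real.log (1 + y)) atTop atTop :=
      tendsto_atTop_add_const_left _ _
        (Real.tendsto_log_atTop.comp (tendsto_atTop_add_const_left _ _ tendsto_id))
    have := (tendsto_rpow_neg_atTop (show 0 < P - 1 by linarith)).comp ht
    simpa [Function.comp_def] using this

/-- The radial profile `(1 + r)^{-k} / (1 + log (1 + r))` of the extremal functions. -/
def extremalProfile (k : ℕ) (r : ℝ) : ℝ := ((1 + r) ^ k)⁻¹ * (1 + Real.log (1 + r))⁻¹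

theorem one_add_log_one_add_pos {r : ℝ} (hr : 0 ≤ r) : 1 ≤ 1 + Real.log (1 + r) := by
  have := Real.log_nonneg (show 1 ≤ 1 + r by linarith)
  linarith

theorem extremalProfile_pos (k : ℕ) {r : ℝ} (hr : 0 ≤ r) : 0 < extremalProfile k r := by
  have := one_add_log_one_add_pos hr
  unfold extremalProfile
  positivity

theorem extremalProfile_anti (k : ℕ) {r s : ℝ} (hr : 0 ≤ r) (hrs : r ≤ s) :
    extremalProfile k s ≤ extremalProfile k r := by
  have h1 := one_add_log_one_add_pos hr
  have h2 := one_add_log_one_add_pos (hr.trans hrs)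
  have h3 : Real.log (1 + r) ≤ Real.log (1 + s) := Real.log_le_log (by linarith) (by linarith)
  unfold extremalProfile
  gcongr

theorem extremalProfile_le_one (k : ℕ) {r : ℝ} (hr : 0 ≤ r) : extremalProfile k r ≤ 1 :=
  (extremalProfile_anti k le_rfl hr).trans (by simp [extremalProfile])

theorem measurable_extremalProfile (k : ℕ) : Measurable (extremalProfile k) := by
  unfold extremalProfile
  fun_prop

/-- In polar coordinates `m ≤ P k` gives `y ^ (m - 1) (1 + y) ^ (-k P) ≤ (1 + y)⁻¹`, so the
logarithmic integral dominates. -/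
theorem lintegral_extremalProfile_rpow_lt_top {k m : ℕ} (hm : 0 < m) {P : ℝ} (hP : 1 < P)
    (hmP : (m : ℝ) ≤ P * k) :
    ∫⁻ x : EuclideanSpace ℝ (Fin m), ENNReal.ofReal (extremalProfile k ‖x‖ ^ P) < ∞ := by
  have : Nontrivial (EuclideanSpace ℝ (Fin m)) := by
    have : Nonempty (Fin m) := ⟨⟨0, hm⟩⟩
    infer_instance
  have hint : Integrable (fun x : EuclideanSpace ℝ (Fin m) => extremalProfile k ‖x‖ ^ P) := by
    refine (integrable_fun_norm_addHaar volume (f := fun r => extremalProfile k r ^ P)).2 ?_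
    refine (integrableOn_inv_mul_log_rpow hP).mono' ?_ ?_
    · exact Measurable.aestronglyMeasurable ((by fun_prop : Measurable fun y : ℝ =>
        y ^ (finrank ℝ (EuclideanSpace ℝ (Fin m)) - 1)).smul
          ((measurable_extremalProfile k).pow_const P))
    · refine (ae_restrict_mem measurableSet_Ioi).mono fun y (hy : 0 < y) => ?_
      have hl := one_add_log_one_add_pos hy.le
      have hy1 : 1 ≤ 1 + y := by linarith
      have hy0 : 0 < 1 + y := by linarith
      rw [smul_eq_mul, Real.norm_of_nonneg (mul_nonneg (by positivity)
        (Real.rpow_nonneg (extremalProfile_pos k hy.le).le _)), finrank_euclideanSpace_fin,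
        extremalProfile, Real.mul_rpow (by positivity) (by positivity), ← mul_assoc,
        Real.inv_rpow (by positivity), Real.inv_rpow (by positivity),
        ← Real.rpow_neg (x := 1 + Real.log (1 + y)) (by linarith)]
      gcongr
      rw [← Real.rpow_natCast (1 + y) k, ← Real.rpow_mul hy0.le,
        ← div_eq_mul_inv, div_le_iff₀ (by positivity), inv_mul_eq_div, le_div_iff₀ hy0]
      calc y ^ (m - 1) * (1 + y) ≤ (1 + y) ^ (m - 1) * (1 + y) := by gcongr; linarith
        _ = (1 + y) ^ (m : ℝ) := by
          rw [← pow_succ, Nat.sub_add_cancel hm, Real.rpow_natCast]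
        _ ≤ (1 + y) ^ ((k : ℝ) * P) := Real.rpow_le_rpow_of_exponent_le hy1 (by linarith)
  have := hint.2
  rw [hasFiniteIntegral_iff_enorm] at this
  refine lt_of_eq_of_lt (lintegral_congr fun x => ?_) this
  rw [Real.enorm_of_nonneg (Real.rpow_nonneg (extremalProfile_pos k (norm_nonneg x)).le _)]

-- In polar coordinates the integrand dominates, up to a constant, the derivative of the unbounded
-- function `log (1 + log (1 + y + a))`. The shift `a` accommodates planes away from the origin.
open Filter Topology Asymptotics in
theorem lintegral_extremalProfile_add {k : ℕ} (hk : 0 < k) {a : ℝ} (ha : 0 ≤ a) :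
    ∫⁻ x : EuclideanSpace ℝ (Fin k), ENNReal.ofReal (extremalProfile k (‖x‖ + a)) = ∞ := by
  have : Nontrivial (EuclideanSpace ℝ (Fin k)) := by
    have : Nonempty (Fin k) := ⟨⟨0, hk⟩⟩
    infer_instance
  by_contra hne
  have hint : Integrable (fun x : EuclideanSpace ℝ (Fin k) => extremalProfile k (‖x‖ + a)) := by
    refine ⟨((measurable_extremalProfile k).comp (by fun_prop)).aestronglyMeasurable, ?_⟩
    rw [hasFiniteIntegral_iff_enorm]
    refine lt_of_eq_of_lt (lintegral_congr fun x => ?_) (Ne.lt_top hne)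
    rw [Real.enorm_of_nonneg (extremalProfile_pos k (by positivity)).le]
  rw [integrable_fun_norm_addHaar volume (f := fun r => extremalProfile k (r + a)),
    finrank_euclideanSpace_fin] at hint
  have hd {y : ℝ} (hy : 0 ≤ y) : HasDerivAt
      (fun y : ℝ => Real.log (1 + Real.log (1 + (y + a))))
      ((1 + (y + a))⁻¹ * (1 + Real.log (1 + (y + a)))⁻¹) y := by
    have h0 := one_add_log_one_add_pos (add_nonneg hy ha)
    have h1 : HasDerivAt (fun y : ℝ => 1 + Real.log (1 + (y + a))) ((1 + (y + a))⁻¹) y := by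
      simpa using ((((hasDerivAt_id y).add_const a).const_add 1).log
        (by simp; linarith)).const_add 1
    exact h1.log (by linarith)
  refine not_integrableOn_of_tendsto_norm_atTop_of_deriv_isBigO_filter
    (f := fun y : ℝ => Real.log (1 + Real.log (1 + (y + a)))) atTop (Ioi_mem_atTop 0)
    ?_ ?_ ?_ hint
  · filter_upwards [eventually_ge_atTop 0] with y hy using (hd hy).differentiableAt
  · refine tendsto_norm_atTop_atTop.comp (Real.tendsto_log_atTop.comp
      (tendsto_atTop_add_const_left _ _ (Real.tendsto_log_atTop.comp
        (tendsto_atTop_add_const_left _ _ (tendsto_atTop_add_const_right _ _ tendsto_id)))))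
  · refine IsBigO.of_bound (2 ^ (k - 1)) ?_
    -- For `y ≥ 1 + a` one has `1 + y + a ≤ 2 y`, whence the constant `2 ^ (k - 1)`.
    filter_upwards [eventually_ge_atTop (1 + a)] with y hy
    have hy0 : 0 < y := by linarith
    have h0 := one_add_log_one_add_pos (add_nonneg hy0.le ha)
    have hs : 0 < 1 + (y + a) := by linarith
    rw [(hd hy0.le).deriv, smul_eq_mul, Real.norm_of_nonneg (by positivity),
      Real.norm_of_nonneg (mul_nonneg (by positivity)
        (extremalProfile_pos k (add_nonneg hy0.le ha)).le), extremalProfile, ← mul_assoc,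
        ← mul_assoc]
    gcongr
    rw [← div_eq_mul_inv, le_div_iff₀ (by positivity), ← mul_pow]
    calc (1 + (y + a))⁻¹ * (1 + (y + a)) ^ k = (1 + (y + a)) ^ (k - 1) := by
          rw [inv_mul_eq_div, div_eq_iff hs.ne', ← pow_succ, Nat.sub_add_cancel hk]
      _ ≤ (2 * y) ^ (k - 1) := by gcongr; linarith

variable {j k l : ℕ} {V : Type*} [NormedAddCommGroup V] [InnerProductSpace ℝ V]
  [FiniteDimensional ℝ V] [CompleteSpace V] [MeasurableSpace V] [BorelSpace V]

theorem LinGrass.nonempty_of_le_finrank (h : j ≤ finrank ℝ V) : Nonempty (LinGrass j V) := by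
  have hli := (finBasis ℝ V).linearIndependent.comp (Fin.castLE h) (Fin.castLE_injective h)
  exact ⟨⟨_, (finrank_span_eq_card hli).trans (Fintype.card_fin j)⟩⟩

theorem memLp_extremalProfile_foot (hV : finrank ℝ V = j + (k + l)) (hk : 0 < k) (hl : 0 < l)
    {p : ℝ≥0∞} (hp : p ≠ ∞ → (k : ℝ) + l ≤ p.toReal * k) :
    MemLp (fun τ : AffGrass j V => extremalProfile k ‖τ.foot‖) p (affGrassMeasure j V) := by
  have hm : Measurable fun τ : AffGrass j V => extremalProfile k ‖τ.foot‖ :=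
    (measurable_extremalProfile k).comp AffGrass.measurable_foot.norm
  rcases eq_or_ne p ∞ with rfl | hpt
  · refine memLp_top_of_bound hm.aestronglyMeasurable 1 (ae_of_all _ fun τ => ?_)
    rw [Real.norm_of_nonneg (extremalProfile_pos k (norm_nonneg _)).le]
    exact extremalProfile_le_one k (norm_nonneg _)
  · have hk' : (0 : ℝ) < k := by exact_mod_cast hk
    have hl' : (0 : ℝ) < l := by exact_mod_cast hl
    -- Here `l > 0` is essential: it forces `p > 1`, which convergence of the logarithmic integral
    -- requires.
    have hP : 1 < p.toReal := by
      have := hp hpt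
      by_contra! hle
      nlinarith
    have hp0 : p ≠ 0 := by
      rintro rfl
      simp at hP
      linarith
    refine ⟨hm.aestronglyMeasurable,
      (eLpNorm_lt_top_iff_lintegral_rpow_enorm_lt_top hp0 hpt).2 ?_⟩
    have h := (lintegral_fun_norm_foot_le hV (w := fun r =>
      ENNReal.ofReal (extremalProfile k r ^ p.toReal))
      ((measurable_extremalProfile k).pow_const _).ennreal_ofReal).trans_lt
      (lintegral_extremalProfile_rpow_lt_top (by lia) hP (by push_cast; exact hp hpt))
    refine lt_of_eq_of_lt (lintegral_congr fun τ => ?_) h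
    rw [Real.enorm_of_nonneg (extremalProfile_pos k (norm_nonneg _)).le,
      ENNReal.ofReal_rpow_of_pos (extremalProfile_pos k (norm_nonneg _))]

/-- The foot of `ξ + u + v` has norm at most `‖u‖ + ‖v‖` and the profile decreases, so the integral
over `u` is infinite for every `ξ`, and the `ξ` have total mass one. -/
theorem mixedRadon_extremalProfile_foot (hV : finrank ℝ V = j + (k + l)) (hk : 0 < k)
    (ζ : AffGrass k V) :
    mixedRadon j (fun τ : AffGrass j V => ENNReal.ofReal (extremalProfile k ‖τ.foot‖)) ζ = ∞ := by
  have hm : Measurable fun τ : AffGrass j V => ENNReal.ofReal (extremalProfile k ‖τ.foot‖) :=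
    ((measurable_extremalProfile k).comp AffGrass.measurable_foot.norm).ennreal_ofReal
  rw [mixedRadon_eq_mixedRadonAt hm, mixedRadonAt, eq_top_iff]
  have hd : finrank ℝ ζ.dir.1ᗮ = j + l := ζ.dir.finrank_orthogonal (by lia)
  obtain ⟨ξ⟩ : Nonempty (LinGrass j ζ.dir.1ᗮ) := LinGrass.nonempty_of_le_finrank (by lia)
  have := isProbabilityMeasure_linGrassMeasure ξ
  calc (∞ : ℝ≥0∞) = ∫⁻ _ : LinGrass j ζ.dir.1ᗮ, ∞ ∂linGrassMeasure j ζ.dir.1ᗮ := by simp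
    _ ≤ _ := by
      refine lintegral_mono fun ξ => ?_
      have hw : Measurable fun r => ENNReal.ofReal (extremalProfile k (r + ‖ζ.foot‖)) :=
        ((measurable_extremalProfile k).comp (by fun_prop)).ennreal_ofReal
      rw [← lintegral_extremalProfile_add hk (norm_nonneg ζ.foot),
        ← lintegral_fun_norm_eq ζ.dir.2 hw]
      refine lintegral_mono fun u => ENNReal.ofReal_le_ofReal ?_
      refine extremalProfile_anti k (norm_nonneg _) ?_
      rw [LinGrass.foot_plane]
      exact (Submodule.norm_starProjection_apply_le _ _).trans (norm_add_le _ _)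

/-- The two assertions about `R_{j,k}`: existence for `p < (n - j) / k`, and sharpness. -/
theorem mixedRadon_existence_and_sharpness {n : ℕ} (hn : finrank ℝ V = n) (hk : 0 < k)
    (hjk : j + k < n) :
    (∀ p : ℝ≥0∞, 1 ≤ p → p < ((n : ℝ≥0∞) - j) / k →
      ∀ f : AffGrass j V → ℂ, MemLp f p (affGrassMeasure j V) →
        ∀ᵐ ζ ∂(affGrassMeasure k V), MixedRadonFinite j f ζ) ∧
    (∀ p : ℝ≥0∞, ((n : ℝ≥0∞) - j) / k ≤ p →
      ∃ f : AffGrass j V → ℝ, (∀ τ, 0 ≤ f τ) ∧ MemLp f p (affGrassMeasure j V) ∧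
        ∀ ζ : AffGrass k V, mixedRadon j (fun τ => ENNReal.ofReal (f τ)) ζ = ∞) := by
  obtain ⟨l, rfl⟩ : ∃ l, n = j + (k + l) := ⟨n - (j + k), by lia⟩
  have hl : 0 < l := by lia
  have hk0 : (k : ℝ≥0∞) ≠ 0 := by simpa using hk.ne'
  have hsub : (((j + (k + l) : ℕ) : ℝ≥0∞) - j) = ((k + l : ℕ) : ℝ≥0∞) := by
    push_cast
    rw [ENNReal.add_sub_cancel_left (by simp)]
  rw [hsub]
  refine ⟨fun p hp hpk f hf => ?_, fun p hp => ?_⟩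
  · obtain ⟨η⟩ : Nonempty (LinGrass k V) := LinGrass.nonempty_of_le_finrank (by lia)
    have hd : finrank ℝ η.1ᗮ = j + l := η.finrank_orthogonal (by lia)
    obtain ⟨ξ⟩ : Nonempty (LinGrass j η.1ᗮ) := LinGrass.nonempty_of_le_finrank (by lia)
    have hpt : p ≠ ∞ := hpk.ne_top
    refine ae_mixedRadonFinite hn η ξ hp hpt ?_ hf
    rw [ENNReal.lt_div_iff_mul_lt (.inl hk0) (.inl (by simp))] at hpk
    have h := (ENNReal.toReal_lt_toReal (ENNReal.mul_ne_top hpt (by simp)) (by simp)).2 hpk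
    rw [ENNReal.toReal_mul, ENNReal.toReal_natCast, ENNReal.toReal_natCast] at h
    exact_mod_cast h
  · refine ⟨fun τ => extremalProfile k ‖τ.foot‖,
      fun τ => (extremalProfile_pos k (norm_nonneg _)).le,
      memLp_extremalProfile_foot hn hk hl fun hpt => ?_, mixedRadon_extremalProfile_foot hn hk⟩
    rw [ENNReal.div_le_iff hk0 (by simp)] at hp
    have h := ENNReal.toReal_mono (ENNReal.mul_ne_top hpt (by simp)) hp
    rw [ENNReal.toReal_mul, ENNReal.toReal_natCast, ENNReal.toReal_natCast] at h
    exact_mod_cast h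

end Sharpness

theorem mainTheorem8 (n j k : ℕ) (hj : 0 < j) (hk : 0 < k) (hjk : j + k < n) :
    -- existence for `R_{j,k}`, and its sharpness
    (∀ p : ℝ≥0∞, 1 ≤ p → p < ((n : ℝ≥0∞) - j) / k →
      ∀ f : AffGrass j (EuclideanSpace ℝ (Fin n)) → ℂ,
        MemLp f p (affGrassMeasure j (EuclideanSpace ℝ (Fin n))) →
        ∀ᵐ ζ ∂(affGrassMeasure k (EuclideanSpace ℝ (Fin n))), MixedRadonFinite j f ζ) ∧
    (∀ p : ℝ≥0∞, ((n : ℝ≥0∞) - j) / k ≤ p →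
      ∃ f : AffGrass j (EuclideanSpace ℝ (Fin n)) → ℝ, (∀ τ, 0 ≤ f τ) ∧
        MemLp f p (affGrassMeasure j (EuclideanSpace ℝ (Fin n))) ∧
        ∀ ζ : AffGrass k (EuclideanSpace ℝ (Fin n)),
          mixedRadon j (fun τ => ENNReal.ofReal (f τ)) ζ = ∞) ∧
    -- existence for `R_{k,j}`, and its sharpness
    (∀ q : ℝ≥0∞, 1 ≤ q → q < ((n : ℝ≥0∞) - k) / j →
      ∀ φ : AffGrass k (EuclideanSpace ℝ (Fin n)) → ℂ,
        MemLp φ q (affGrassMeasure k (EuclideanSpace ℝ (Fin n))) →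
        ∀ᵐ τ ∂(affGrassMeasure j (EuclideanSpace ℝ (Fin n))), MixedRadonFinite k φ τ) ∧
    (∀ q : ℝ≥0∞, ((n : ℝ≥0∞) - k) / j ≤ q →
      ∃ φ : AffGrass k (EuclideanSpace ℝ (Fin n)) → ℝ, (∀ ζ, 0 ≤ φ ζ) ∧
        MemLp φ q (affGrassMeasure k (EuclideanSpace ℝ (Fin n))) ∧
        ∀ τ : AffGrass j (EuclideanSpace ℝ (Fin n)),
          mixedRadon k (fun ζ => ENNReal.ofReal (φ ζ)) τ = ∞) := by
  have hn : finrank ℝ (EuclideanSpace ℝ (Fin n)) = n := finrank_euclideanSpace_fin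
  obtain ⟨h1, h2⟩ := mixedRadon_existence_and_sharpness (j := j) hn hk hjk
  -- The hypothesis `j + k < n` is symmetric, so the dual statements follow by exchanging `j` and
  -- `k`.
  obtain ⟨h3, h4⟩ := mixedRadon_existence_and_sharpness (j := k) (k := j) hn hj (by lia)
  exact ⟨h1, h2, h3, h4⟩
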